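/- Let $\Lambda\subset\mathbb R^3$ be an oriented Legendrian knot for the contact form $dz-y\,dx$ whose $xy$-projection is an immersion with finitely many double points, all transverse, and let $*\in\Lambda$ be a single base point that is not an endpoint of a Reeb chord. Let $\rho$ be the absolute value of the rotation number of $\Lambda$, and let $(\mathcal A,\partial)=(\mathcal A(\Lambda),\partial)$ be the Chekanov–Eliashberg DGA of $\Lambda$ (for any choice of orientation signs): the $\mathbb Z/2\rho$-graded semi-free DGA over $\mathbb Z$ generated by the Reeb chords $a_1,\dots,a_r$ and by $t^{\pm1}$ (with $tt^{-1}=t^{-1}t=1$, $|t|=0$, $\partial t=0$), where $\partial a_k$ is the signed count of immersed disks in the $xy$-plane with boundary on the projection of $\Lambda$, one positive corner, at $a_k$, and any number of negative corners. Let $\Bbbk$ be a commutative ring. A $\Bbbk$-augmentation is a DGA map $\epsilon:(\mathcal A,\partial)\to(\Bbbk,0)$, where $\Bbbk$ lies in degree $0$. Two augmentations $\epsilon_1,\epsilon_2$ are DGA homotopic if there is an additive map $K:\mathcal A\to\Bbbk$ of degree $+1$ with $\epsilon_1-\epsilon_2=K\circ\partial$ and $K(xy)=K(x)\epsilon_2(y)+(-1)^{|x|}\epsilon_1(x)K(y)$.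 The category $\mathcal{A}ug_+(\Lambda,\Bbbk)$ is the $A_\infty$-category whose objects are the $\Bbbk$-augmentations of $\mathcal A$, defined from the $m$-copies of the Lagrangian projection as follows. Every $\hom(\epsilon,\epsilon')$ is the free $\Bbbk$-module on $a_1^+,\dots,a_r^+,x^+,y^+$, with $|a_k^+|=|a_k|+1$, $|x^+|=1$, $|y^+|=0$. The DGA $(\mathcal A^m,\partial^m)$ of the $m$-copy is generated by $a_k^{ij}$ $(1\le i,j\le m)$, $x^{ij},y^{ij}$ $(1\le i<j\le m)$ and invertible $t^i$ $(1\le i\le m)$, of degrees $|a_k^{ij}|=|a_k|$, $|x^{ij}|=0$, $|y^{ij}|=-1$, $|t^i|=0$. In terms of the matrices $A_k=(a_k^{ij})$, $X$ (upper triangular with $1$ on the diagonal and $x^{ij}$ above it), $Y$ (strictly upper triangular with entries $y^{ij}$) and $\Delta=\mathrm{Diag}(t^1,\dots,t^m)$, its differential is given by $$\partial^m A_k=\Phi(\partial a_k)+YA_k-(-1)^{|a_k|}A_kY,\qquad \partial^m X=\Delta^{-1}Y\Delta X-XY,\qquad \partial^mY=Y^2,\qquad \partial^m\Delta=0,$$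 where $\Phi$ is the ring homomorphism with $\Phi(a_k)=A_k$ and $\Phi(t)=\Delta X$. For augmentations $\epsilon_1,\dots,\epsilon_{p+1}$ let $\epsilon$ be the augmentation of $\mathcal A^{p+1}$ with $\epsilon(a_k^{ii})=\epsilon_i(a_k)$, $\epsilon(t^i)=\epsilon_i(t)$ and $\epsilon=0$ on the other generators, and let $\partial_\epsilon=\phi_\epsilon\circ\partial^{p+1}\circ\phi_\epsilon^{-1}$, with $\phi_\epsilon(s)=s+\epsilon(s)$, on $(\mathcal A^{p+1}\otimes\Bbbk)/(t^i=\epsilon_i(t))$. Then $m_p:\hom(\epsilon_p,\epsilon_{p+1})\otimes\cdots\otimes\hom(\epsilon_1,\epsilon_2)\to\hom(\epsilon_1,\epsilon_{p+1})$ is $$m_p(\alpha_p^+,\dots,\alpha_1^+)=(-1)^\sigma\sum_{g\in\{a_1,\dots,a_r,x,y\}}\mathrm{Coeff}_{\alpha_1^{12}\alpha_2^{23}\cdots\alpha_p^{p,p+1}}\bigl(\partial_\epsilon g^{1,p+1}\bigr)\,g^+,$$ $$\sigma=\tfrac{p(p-1)}2+\sum_{i<j}|\alpha_i^+||\alpha_j^+|+|\alpha_{p-1}^+|+|\alpha_{p-3}^+|+\cdots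 .$$ Two augmentations are isomorphic in $\mathcal{A}ug_+(\Lambda,\Bbbk)$ if they are isomorphic in the cohomology category $H^0\mathcal{A}ug_+(\Lambda,\Bbbk)$. Then two augmentations $\epsilon_1,\epsilon_2:\mathcal A\to\Bbbk$ are DGA homotopic if and only if they are isomorphic in $\mathcal{A}ug_+(\Lambda,\Bbbk)$. -/

import Mathlib

open scoped ContDiff

noncomputable section

/-! ### Semi-free algebras and semi-free differential graded algebras -/

/-- Words in the generators `R` and in the invertible generators `T`: the free product of the free
monoid on `R` with the free group on `T`. -/
abbrev SFMonoid (R T : Type) : Type := Monoid.Coprod (FreeMonoid R) (FreeGroup T)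

/-- The unital associative `ℤ`-algebra generated by `R`, `T` and inverses of the elements of `T`,
with only the relations `t * t⁻¹ = t⁻¹ * t = 1`. -/
abbrev SFAlg (R T : Type) : Type := MonoidAlgebra ℤ (SFMonoid R T)

namespace SFAlg

variable {R T : Type}

/-- The generator `a`. -/
def gen (a : R) : SFAlg R T := MonoidAlgebra.of ℤ (SFMonoid R T) (.inl (.of a))

/-- The invertible generator `t`. -/
def tUnit (t : T) : (SFAlg R T)ˣ :=
  Units.map (MonoidAlgebra.of ℤ (SFMonoid R T))
    (Units.map (Monoid.Coprod.inr : FreeGroup T →* SFMonoid R T) (toUnits (FreeGroup.of t)))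

/-- The ring homomorphism with prescribed values on the generators. -/
def lift {B : Type*} [Ring B] (f : R → B) (τ : T → Bˣ) : SFAlg R T →+* B :=
  (MonoidAlgebra.lift ℤ B (SFMonoid R T)
    (Monoid.Coprod.lift (FreeMonoid.lift f)
      ((Units.coeHom B).comp (FreeGroup.lift τ)))).toRingHom

/-- The degree of a word, where `a : R` has degree `deg a` and every `t : T` has degree `0`. -/
def wordDegree {n : ℕ} (deg : R → ZMod n) : SFMonoid R T →* Multiplicative (ZMod n) :=
  Monoid.Coprod.lift (FreeMonoid.lift fun a => Multiplicative.ofAdd (deg a)) 1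

/-- `x` is homogeneous of degree `i`. -/
def IsHomogeneous {n : ℕ} (deg : R → ZMod n) (i : ZMod n) (x : SFAlg R T) : Prop :=
  ∀ w ∈ x.coeff.support, wordDegree deg w = Multiplicative.ofAdd i

open Classical in
/-- The sign `(-1) ^ i` (used for `i` in `ZMod n` with `n` even). -/
def degSign {n : ℕ} (i : ZMod n) : ℤ := if Even i then 1 else -1

/-- The ring automorphism `x ↦ (-1) ^ |x| x` (on homogeneous `x`). -/
def signHom {n : ℕ} (deg : R → ZMod n) : SFAlg R T →+* SFAlg R T :=
  lift (fun a => degSign (deg a) • gen a) tUnit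

end SFAlg

open SFAlg

/-- A semi-free differential graded algebra, graded by `ℤ / 2ρ`, with generators `R` and invertible
generators `T`; the differential is a derivation of degree `-1` and kills the elements of `T`. -/
structure SemiFreeDGA (ρ : ℕ) (R T : Type) where
  deg : R → ZMod (2 * ρ)
  d : SFAlg R T →+ SFAlg R T
  d_degree : ∀ i x, IsHomogeneous deg i x → IsHomogeneous deg (i - 1) (d x)
  d_mul : ∀ x y, d (x * y) = d x * y + signHom deg x * d y
  d_t : ∀ t : T, d (tUnit t : (SFAlg R T)ˣ).val = 0
  d_d : ∀ x, d (d x) = 0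

/-- A `k`-augmentation: a DGA map to `k`, where `k` has zero grading and zero differential. -/
structure Augmentation {ρ : ℕ} {R T : Type} (𝓐 : SemiFreeDGA ρ R T) (k : Type*) [CommRing k] where
  toRingHom : SFAlg R T →+* k
  map_of_degree_ne_zero : ∀ i x, i ≠ 0 → IsHomogeneous 𝓐.deg i x → toRingHom x = 0
  map_d : ∀ x, toRingHom (𝓐.d x) = 0

/-- DGA homotopy of two augmentations, as DGA maps to `(k, 0)`: there is an `(ε₁, ε₂)`-derivation
`K` of degree `+1` with `ε₁ - ε₂ = K ∘ ∂` (the term `∂ ∘ K` vanishes in `(k, 0)`). -/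
def DGAHomotopic {ρ : ℕ} {R T : Type} {𝓐 : SemiFreeDGA ρ R T} {k : Type*} [CommRing k]
    (ε₁ ε₂ : Augmentation 𝓐 k) : Prop :=
  ∃ K : SFAlg R T →+ k,
    (∀ i x, i + 1 ≠ 0 → IsHomogeneous 𝓐.deg i x → K x = 0) ∧
    (∀ x, ε₁.toRingHom x - ε₂.toRingHom x = K (𝓐.d x)) ∧
    (∀ x y, K (x * y) =
      K x * ε₂.toRingHom y + ε₁.toRingHom (signHom 𝓐.deg x) * K y)

/-! ### The `m`-copy algebras of a semi-free DGA with one invertible generator -/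

/-- Generators of the `m`-copy algebra, apart from the invertible generators `t^i`. -/
inductive MGen (R : Type) (m : ℕ) : Type
  | a (k : R) (i j : Fin m) : MGen R m
  | x (i j : Fin m) (h : i < j) : MGen R m
  | y (i j : Fin m) (h : i < j) : MGen R m

/-- The `m`-copy algebra. -/
abbrev MAlg (R : Type) (m : ℕ) : Type := SFAlg (MGen R m) (Fin m)

namespace MAlg

variable {R : Type} {m : ℕ}

/-- `A_k = (a_k^{ij})`. -/
def matA (k : R) : Matrix (Fin m) (Fin m) (MAlg R m) := fun i j => gen (.a k i j)

/-- The strictly upper triangular part of the unipotent matrix `X`. -/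
def matN : Matrix (Fin m) (Fin m) (MAlg R m) := fun i j => if h : i < j then gen (.x i j h) else 0

/-- `Y`. -/
def matY : Matrix (Fin m) (Fin m) (MAlg R m) := fun i j => if h : i < j then gen (.y i j h) else 0

theorem matN_pow (p : ℕ) (i j : Fin m) (h : (j : ℕ) < i + p) :
    ((matN : Matrix (Fin m) (Fin m) (MAlg R m)) ^ p) i j = 0 := by
  induction p generalizing j with
  | zero => rw [pow_zero, Matrix.one_apply_ne]; intro e; subst e; simp at h
  | succ p ih =>
    rw [pow_succ, Matrix.mul_apply]
    refine Finset.sum_eq_zero fun l _ => ?_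
    by_cases hl : (l : ℕ) < i + p
    · rw [ih l hl, zero_mul]
    · have : ¬ l < j := by rw [Fin.lt_def]; omega
      simp [matN, this]

theorem matN_nilpotent : IsNilpotent (matN : Matrix (Fin m) (Fin m) (MAlg R m)) :=
  ⟨m, by ext i j; rw [matN_pow m i j (by omega)]; rfl⟩

/-- The upper triangular matrix `X`, with diagonal entries `1` and entries `x^{ij}` above the
diagonal, as an invertible matrix. -/
def matX : (Matrix (Fin m) (Fin m) (MAlg R m))ˣ :=
  (matN_nilpotent (R := R) (m := m)).isUnit_one_add.unit

/-- `Δ = Diag(t^1, …, t^m)`, as an invertible matrix. -/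
def matΔ : (Matrix (Fin m) (Fin m) (MAlg R m))ˣ :=
  Units.map (Matrix.diagonalRingHom (Fin m) (MAlg R m)).toMonoidHom
    (MulEquiv.piUnits.symm fun i => tUnit i)

/-- The ring homomorphism `Φ` with `Φ(a_k) = A_k` and `Φ(t) = Δ X`. -/
def Φ : SFAlg R Unit →+* Matrix (Fin m) (Fin m) (MAlg R m) :=
  SFAlg.lift matA fun _ => matΔ * matX

end MAlg

open MAlg

/-- The differential `∂^m` of the `m`-copy algebra, on generators:
`∂ A_k = Φ(∂ a_k) + Y A_k - (-1)^{|a_k|} A_k Y`, `∂ X = Δ⁻¹ Y Δ X - X Y` and `∂ Y = Y ^ 2`.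
(It extends to the algebra by `∂ t^i = 0` and the Leibniz rule.) -/
def SemiFreeDGA.mCopyD {ρ : ℕ} {R : Type} (𝓐 : SemiFreeDGA ρ R Unit) (m : ℕ) :
    MGen R m → MAlg R m
  | .a k i j => (Φ (𝓐.d (gen k)) + matY * matA k - degSign (𝓐.deg k) • (matA k * matY) :
      Matrix (Fin m) (Fin m) (MAlg R m)) i j
  | .x i j _ => ((matΔ⁻¹).val * matY * matΔ.val * matX.val - matX.val * matY :
      Matrix (Fin m) (Fin m) (MAlg R m)) i j
  | .y i j _ => (matY * matY : Matrix (Fin m) (Fin m) (MAlg R m)) i j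

/-! ### The positive augmentation category -/

/-- The two short generators. -/
inductive ShortGen : Type
  | x | y
  deriving DecidableEq

instance : Fintype ShortGen := ⟨{.x, .y}, by intro a; cases a <;> simp⟩

/-- The index set of the basis `a_k^+`, `x^+`, `y^+` of the morphism modules. -/
abbrev HomGen (R : Type) : Type := R ⊕ ShortGen

/-- The generator of the `m`-copy algebra in position `(i, j)` named by `g`. -/
def HomGen.at {R : Type} {m : ℕ} (g : HomGen R) (i j : Fin m) (h : i < j) : MGen R m :=
  match g with
  | .inl k => .a k i j
  | .inr .x => .x i j h
  | .inr .y => .y i j h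

/-- The degrees `|a_k^+| = |a_k| + 1`, `|x^+| = 1` and `|y^+| = 0`. -/
def SemiFreeDGA.homDeg {ρ : ℕ} {R : Type} (𝓐 : SemiFreeDGA ρ R Unit) : HomGen R → ZMod (2 * ρ)
  | .inl k => 𝓐.deg k + 1
  | .inr .x => 1
  | .inr .y => 0

open Classical in
/-- The parity of the degree of a basis element. -/
def SemiFreeDGA.parity {ρ : ℕ} {R : Type} (𝓐 : SemiFreeDGA ρ R Unit) (g : HomGen R) : ℕ :=
  if Even (𝓐.homDeg g) then 0 else 1

/-- The exponent
`p (p - 1) / 2 + ∑_{i < j} |α_i| |α_j| + |α_{p-1}| + |α_{p-3}| + ⋯` for `α = (α_1, …, α_p)`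
(indexed below by `0, …, p - 1`). -/
def SemiFreeDGA.sigma {ρ : ℕ} {R : Type} (𝓐 : SemiFreeDGA ρ R Unit) {p : ℕ}
    (α : Fin p → HomGen R) : ℕ :=
  p * (p - 1) / 2
    + ∑ i, ∑ j, (if i < j then 𝓐.parity (α i) * 𝓐.parity (α j) else 0)
    + ∑ i : Fin p, (if (p - 1 - (i : ℕ)) % 2 = 1 then 𝓐.parity (α i) else 0)

/-- The morphism module of the augmentation category between any two augmentations: the free
`k`-module on `a_k^+`, `x^+`, `y^+`, an element being given by its coefficients. -/
abbrev AugHom (R : Type) (k : Type*) : Type _ := HomGen R → k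

namespace AugPlus

variable {ρ : ℕ} {R : Type} {𝓐 : SemiFreeDGA ρ R Unit} {k : Type*} [CommRing k]

open Classical in
/-- Let `ε = (ε_1, …, ε_m)` be the diagonal augmentation of the `m`-copy algebra `𝓐^m`. This is the
composite of the quotient map from `𝓐^m` to
`(𝓐^m)^ε = (𝓐^m ⊗ k) / (t^i = ε_i(t))`, the free `k`-algebra on the generators other than the `t^i`,
with the automorphism `φ_ε(s) = s + ε(s)`. -/
def twist {m : ℕ} (ε : Fin m → Augmentation 𝓐 k) :
    MAlg R m →+* MonoidAlgebra k (FreeMonoid (MGen R m)) :=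
  SFAlg.lift
    (fun s => MonoidAlgebra.of k (FreeMonoid (MGen R m)) (.of s) +
      match s with
      | .a l i j => if i = j then algebraMap k _ ((ε i).toRingHom (gen l)) else 0
      | .x _ _ _ => 0
      | .y _ _ _ => 0)
    (fun i => Units.map (algebraMap k (MonoidAlgebra k (FreeMonoid (MGen R m)))).toMonoidHom
      (Units.map (ε i).toRingHom.toMonoidHom (tUnit ())))

/-- The twisted differential `∂_ε = φ_ε ∘ ∂ ∘ φ_ε⁻¹` on a generator `s`; since `∂` kills constants
this is `φ_ε (∂ s)`. -/
def twistedD {m : ℕ} (ε : Fin m → Augmentation 𝓐 k) (s : MGen R m) :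
    MonoidAlgebra k (FreeMonoid (MGen R m)) :=
  twist ε (𝓐.mCopyD m s)

/-- The composition `m_p(v_p, …, v_1)`, where `v_i` is a morphism from `ε_i` to `ε_{i+1}`
(with `i` running from `0` in the code). On basis elements it is
`m_p(α_p^+, …, α_1^+) = (-1)^σ ∑_g g^+ Coeff_{α_1^{12} α_2^{23} ⋯ α_p^{p,p+1}} (∂_ε g^{1,p+1})`. -/
def comp [Fintype R] (p : ℕ) [NeZero p] (ε : Fin (p + 1) → Augmentation 𝓐 k)
    (v : Fin p → AugHom R k) : AugHom R k := fun g =>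
  ∑ α : Fin p → HomGen R,
    (-1) ^ 𝓐.sigma α * (∏ i, v i (α i)) *
      (twistedD ε (g.at 0 (Fin.last p) Fin.last_pos')).coeff
        (FreeMonoid.ofList (List.ofFn fun i : Fin p =>
          (α i).at i.castSucc i.succ i.castSucc_lt_succ))

/-- `m_1` on the morphisms from `ε₁` to `ε₂`. -/
def m₁ [Fintype R] (ε₁ ε₂ : Augmentation 𝓐 k) (v : AugHom R k) : AugHom R k :=
  comp 1 ![ε₁, ε₂] ![v]

/-- `m_2(w, v)`, for `v` a morphism from `ε₁` to `ε₂` and `w` a morphism from `ε₂` to `ε₃`. -/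
def m₂ [Fintype R] (ε₁ ε₂ ε₃ : Augmentation 𝓐 k) (w v : AugHom R k) : AugHom R k :=
  comp 2 ![ε₁, ε₂, ε₃] ![v, w]

/-- `v` is of degree `0`. -/
def IsDegreeZero (𝓐 : SemiFreeDGA ρ R Unit) (v : AugHom R k) : Prop :=
  ∀ g, 𝓐.homDeg g ≠ 0 → v g = 0

/-- `v` is a cocycle of degree `0` in the morphisms from `ε₁` to `ε₂`. -/
def IsCocycleZero [Fintype R] (ε₁ ε₂ : Augmentation 𝓐 k) (v : AugHom R k) : Prop :=
  IsDegreeZero 𝓐 v ∧ m₁ ε₁ ε₂ v = 0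

/-- `v` and `w` are cohomologous in the morphisms from `ε₁` to `ε₂`. -/
def Cohomologous [Fintype R] (ε₁ ε₂ : Augmentation 𝓐 k) (v w : AugHom R k) : Prop :=
  ∃ c, v - w = m₁ ε₁ ε₂ c

/-- The class of `u` is the identity morphism of `ε` in the cohomology category. -/
def IsIdentity [Fintype R] (ε : Augmentation 𝓐 k) (u : AugHom R k) : Prop :=
  IsCocycleZero ε ε u ∧
  (∀ ε' v, m₁ ε ε' v = 0 → Cohomologous ε ε' (m₂ ε ε ε' v u) v) ∧
  (∀ ε' v, m₁ ε' ε v = 0 → Cohomologous ε' ε (m₂ ε' ε ε u v) v)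

/-- `ε₁` and `ε₂` are isomorphic in the degree zero cohomology category of the augmentation
category. -/
def Isomorphic [Fintype R] (ε₁ ε₂ : Augmentation 𝓐 k) : Prop :=
  ∃ v w u₁ u₂ : AugHom R k,
    IsCocycleZero ε₁ ε₂ v ∧ IsCocycleZero ε₂ ε₁ w ∧
    IsIdentity ε₁ u₁ ∧ IsIdentity ε₂ u₂ ∧
    Cohomologous ε₁ ε₁ (m₂ ε₁ ε₂ ε₁ w v) u₁ ∧
    Cohomologous ε₂ ε₂ (m₂ ε₂ ε₁ ε₂ v w) u₂

end AugPlus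

/-! ### Legendrian knots and the Chekanov–Eliashberg differential -/

/-- The parameters `s` and `s'` give the same point of `ℝ / ℤ`. -/
def SamePoint (s s' : ℝ) : Prop := ∃ n : ℤ, s' = s + n

/-- An oriented Legendrian knot in `ℝ³` with contact form `dz - y dx`, given by an embedding of
`ℝ / ℤ`, whose `xy`-projection is an immersion that is injective except for finitely many transverse
double points. -/
structure LegendrianKnot where
  x : ℝ → ℝ
  y : ℝ → ℝ
  z : ℝ → ℝ
  smooth_x : ContDiff ℝ ∞ x
  smooth_y : ContDiff ℝ ∞ y
  smooth_z : ContDiff ℝ ∞ z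
  periodic_x : Function.Periodic x 1
  periodic_y : Function.Periodic y 1
  periodic_z : Function.Periodic z 1
  legendrian : ∀ s, deriv z s = y s * deriv x s
  immersed : ∀ s, deriv x s ≠ 0 ∨ deriv y s ≠ 0
  embedded : ∀ s s', x s = x s' → y s = y s' → z s = z s' → SamePoint s s'
  no_triple : ∀ s₁ s₂ s₃, x s₁ = x s₂ → y s₁ = y s₂ → x s₂ = x s₃ → y s₂ = y s₃ →
    SamePoint s₁ s₂ ∨ SamePoint s₂ s₃ ∨ SamePoint s₁ s₃
  transverse : ∀ s s', x s = x s' → y s = y s' → ¬ SamePoint s s' →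
    deriv x s * deriv y s' - deriv y s * deriv x s' ≠ 0
  finite_double : {p : ℝ × ℝ | p.1 ∈ Set.Ico (0 : ℝ) 1 ∧ p.2 ∈ Set.Ico (0 : ℝ) 1 ∧
    p.1 ≠ p.2 ∧ x p.1 = x p.2 ∧ y p.1 = y p.2}.Finite

namespace LegendrianKnot

variable (Λ : LegendrianKnot)

/-- The `xy`-projection of the knot, in `ℂ = ℝ²`. -/
def proj (s : ℝ) : ℂ := ⟨Λ.x s, Λ.y s⟩

/-- The determinant of the tangent vectors of the `xy`-projection at `s` and at `s'`. -/
def cross (s s' : ℝ) : ℝ := deriv Λ.x s * deriv Λ.y s' - deriv Λ.y s * deriv Λ.x s'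

/-- The total change of the angle of the tangent vector of the `xy`-projection from `s` to `s'`. -/
def turning (s s' : ℝ) : ℝ :=
  ∫ r in s..s', (deriv Λ.x r * deriv (deriv Λ.y) r - deriv Λ.y r * deriv (deriv Λ.x) r) /
    (deriv Λ.x r ^ 2 + deriv Λ.y r ^ 2)

/-- The absolute value of the rotation number. -/
def rot : ℕ := (round (Λ.turning 0 1 / (2 * Real.pi))).natAbs

/-- A Reeb chord: a pair `(upper endpoint, lower endpoint)` of parameters. -/
def ReebChord : Type :=
  {p : ℝ × ℝ // p.1 ∈ Set.Ico (0 : ℝ) 1 ∧ p.2 ∈ Set.Ico (0 : ℝ) 1 ∧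
    Λ.x p.1 = Λ.x p.2 ∧ Λ.y p.1 = Λ.y p.2 ∧ Λ.z p.2 < Λ.z p.1}

instance : Finite Λ.ReebChord :=
  (Λ.finite_double.subset (by
    rintro p ⟨h1, h2, hx, hy, hz⟩
    exact ⟨h1, h2, fun e => by rw [e] at hz; exact lt_irrefl _ hz, hx, hy⟩) :
      {p : ℝ × ℝ | p.1 ∈ Set.Ico (0 : ℝ) 1 ∧ p.2 ∈ Set.Ico (0 : ℝ) 1 ∧
        Λ.x p.1 = Λ.x p.2 ∧ Λ.y p.1 = Λ.y p.2 ∧ Λ.z p.2 < Λ.z p.1}.Finite).to_subtype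

instance : Fintype Λ.ReebChord := Fintype.ofFinite _

variable {Λ}

/-- The parameter of the upper endpoint, on the over-strand. -/
def ReebChord.upper (a : Λ.ReebChord) : ℝ := a.1.1

/-- The parameter of the lower endpoint, on the under-strand. -/
def ReebChord.lower (a : Λ.ReebChord) : ℝ := a.1.2

/-- The degree of a Reeb chord in `ℤ / 2ρ`, where `ρ` is the absolute value of the rotation number.
If `θ` is a continuous angle of the tangent vector of the `xy`-projection, then
`s ↦ -⌊θ(s) / π + 1 / 2⌋` is a Maslov potential `μ` off the cusps of the front, and
`⌊(θ(lower) - θ(upper)) / π⌋` equals `μ(upper) - μ(lower)` or `μ(upper) - μ(lower) - 1`, according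
to whether the height of the upper strand over the lower strand has a local maximum or a local
minimum at the chord. -/
def ReebChord.degree (a : Λ.ReebChord) : ZMod (2 * Λ.rot) :=
  (⌊Λ.turning a.upper a.lower / Real.pi⌋ : ℤ)

open Classical in
/-- The orientation sign of the quadrant at the crossing `a` on whose boundary lies the ray `v` times
the direction of the over-strand, `v = ±1`. It is `-1` exactly if the degree of `a` is even and the
quadrant lies on the chosen side of the under-strand (`side a = true` meaning the left side). -/
def ReebChord.orientationSign (side : Λ.ReebChord → Bool) (a : Λ.ReebChord) (v : ℝ) : ℤ :=
  if Even a.degree ∧ (side a = true ↔ 0 < v * Λ.cross a.lower a.upper) then -1 else 1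

variable (Λ)

/-- An immersed disk with positive corner at `a` and negative corners at `b 0, …, b (l - 1)`, in
counterclockwise order. The domain is the closed unit disk in `ℂ`, with boundary punctures at
`exp (I φ 0) = 1, exp (I φ 1), …, exp (I φ l)`. The `i`-th boundary arc is the one from `φ i` to
`φ (i + 1)`, and `lift i` is its lift to the knot.

At a positive corner the boundary arrives on the under-strand and leaves on the over-strand, and at
a negative corner it is the other way round. As the disk lies to the left of its boundary and
occupies a single quadrant, this quadrant then appears counterclockwise, respectively clockwise, to
the over-strand. The Lipschitz condition only restricts the parametrization. -/
structure Disk (a : Λ.ReebChord) where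
  l : ℕ
  b : Fin l → Λ.ReebChord
  φ : Fin (l + 2) → ℝ
  φ_mono : StrictMono φ
  φ_zero : φ 0 = 0
  φ_last : φ (Fin.last (l + 1)) = 2 * Real.pi
  u : ℂ → ℂ
  lipschitz : ∃ C, LipschitzOnWith C u (Metric.closedBall 0 1)
  smooth : ContDiffOn ℝ ∞ u
    (Metric.closedBall 0 1 \ Set.range fun i : Fin (l + 1) => Complex.exp (φ i.castSucc * Complex.I))
  immersed : ∀ w ∈ Metric.closedBall (0 : ℂ) 1 \
      Set.range fun i : Fin (l + 1) => Complex.exp (φ i.castSucc * Complex.I),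
    0 < (fderivWithin ℝ u (Metric.closedBall 0 1) w).det
  lift : Fin (l + 1) → ℝ → ℝ
  lift_continuous : ∀ i, ContinuousOn (lift i) (Set.Icc (φ i.castSucc) (φ i.succ))
  lift_smooth : ∀ i, ContDiffOn ℝ ∞ (lift i) (Set.Ioo (φ i.castSucc) (φ i.succ))
  boundary : ∀ i, ∀ θ ∈ Set.Icc (φ i.castSucc) (φ i.succ),
    u (Complex.exp (θ * Complex.I)) = Λ.proj (lift i θ)
  pos_in : SamePoint a.lower (lift (Fin.last l) (φ (Fin.last (l + 1))))
  pos_out : SamePoint a.upper (lift 0 (φ 0))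
  neg_in : ∀ j : Fin l, SamePoint (b j).upper (lift j.castSucc (φ j.succ.castSucc))
  neg_out : ∀ j : Fin l, SamePoint (b j).lower (lift j.succ (φ j.succ.castSucc))
  quadrant : ∀ i : Fin (l + 1), ∀ᶠ w in
    nhdsWithin (Complex.exp (φ i.castSucc * Complex.I)) (Metric.ball 0 1), u w ∉ Set.range Λ.proj

variable {Λ} {a : Λ.ReebChord}

/-- Equality up to reparametrization. (As `u` and `u'` are immersions, `F` preserves the orientation
and the punctures and is a diffeomorphism away from them.) -/
def Disk.Reparam (D D' : Λ.Disk a) : Prop :=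
  ∃ F : Metric.closedBall (0 : ℂ) 1 ≃ₜ Metric.closedBall (0 : ℂ) 1,
    (∀ w : Metric.closedBall (0 : ℂ) 1, (w : ℂ) = 1 → (F w : ℂ) = 1) ∧
      ∀ w : Metric.closedBall (0 : ℂ) 1, D'.u w = D.u (F w)

/-- `1` or `-1` according to whether the `i`-th boundary arc agrees or disagrees with the orientation
of the knot. -/
def Disk.direction (D : Λ.Disk a) (i : Fin (D.l + 1)) : ℤ :=
  SignType.sign (D.lift i (D.φ i.succ) - D.lift i (D.φ i.castSucc))

/-- The number of times that the `i`-th boundary arc passes the base point, counted with sign. -/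
def Disk.crossings (base : ℝ) (D : Λ.Disk a) (i : Fin (D.l + 1)) : ℤ :=
  ⌊D.lift i (D.φ i.succ) - base⌋ - ⌊D.lift i (D.φ i.castSucc) - base⌋

/-- The product of the orientation signs of the quadrants at the corners. -/
def Disk.sign (side : Λ.ReebChord → Bool) (D : Λ.Disk a) : ℤ :=
  a.orientationSign side (D.direction 0) *
    ∏ j : Fin D.l, (D.b j).orientationSign side (-(D.direction j.castSucc))

/-- The power `t ^ n`. -/
def tPow (Λ : LegendrianKnot) (n : ℤ) : SFAlg Λ.ReebChord Unit :=
  ((tUnit () ^ n : (SFAlg Λ.ReebChord Unit)ˣ) : SFAlg Λ.ReebChord Unit)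

/-- The signed monomial `w(u) = ± t^{e_0} b_1 t^{e_1} ⋯ b_l t^{e_l}`. -/
def Disk.weight (base : ℝ) (side : Λ.ReebChord → Bool) (D : Λ.Disk a) :
    SFAlg Λ.ReebChord Unit :=
  D.sign side • (tPow Λ (D.crossings base 0) *
    (List.ofFn fun j : Fin D.l => gen (D.b j) * tPow Λ (D.crossings base j.succ)).prod)

/-- The Chekanov–Eliashberg differential `∂ a = ∑ w(u)` of a Reeb chord, the sum over all disks with
positive corner at `a` up to reparametrization. -/
def ceDifferential (base : ℝ) (side : Λ.ReebChord → Bool) (a : Λ.ReebChord) :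
    SFAlg Λ.ReebChord Unit :=
  ∑ᶠ q : Quot (Disk.Reparam (Λ := Λ) (a := a)), q.out.weight base side

variable (Λ)

/-- The parameter `base` is a base point away from the double points of the `xy`-projection. -/
def IsBasePoint (base : ℝ) : Prop := ∀ s, Λ.proj s = Λ.proj base → SamePoint base s

/-- `𝓐` is the Chekanov–Eliashberg DGA of `Λ` with the given base point and choice of sides for the
orientation signs. -/
def IsChekanovEliashberg (base : ℝ) (side : Λ.ReebChord → Bool)
    (𝓐 : SemiFreeDGA Λ.rot Λ.ReebChord Unit) : Prop :=
  (∀ a, 𝓐.deg a = a.degree) ∧ ∀ a, 𝓐.d (gen a) = ceDifferential base side a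

end LegendrianKnot

end

/-! An augmentation lives in degree 0, so the sign in the Leibniz rule of a homotopy K disappears: K
is an (ε₁, ε₂)-derivation supported in degree -1. It kills t, hence is determined by its values on
the chords. To K corresponds the morphism -y⁺ - ∑ K(a) a⁺. By the formulas for `m₁`, it is a cocycle
because ε₁ - ε₂ = K ∘ ∂, and K = 0 gives the strict unit -y⁺.

Isomorphic implies homotopic (`Isomorphic.exists_isHomotopy`): `m₁` never hits y⁺, and `m₂`
multiplies the y⁺-coefficients up to sign. Inverse isomorphisms v, w therefore satisfy v_y w_y = 1,
and w_y times the derivation given by v is a homotopy.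

Homotopic implies isomorphic (`isomorphic_of_isHomotopy`): the morphisms of K and L compose to the
one with chord coefficients -(K + L + H ∘ ∂)(a). Here H is the cup product: on a word it sums over
pairs of chords, with K on the earlier, L on the later and augmentations elsewhere. An inverse must
solve L(a) = -K(a) - H(∂a). Stokes' theorem for y dx on a disk bounds the total height of the
negative corners by the height of the positive one (`Disk.sum_height_le`), so a chord preceded by
another in a word of ∂a is strictly lower than a and the recursion is well founded. The same
filtration shows that L is a homotopy (`IsHomotopy.exists_inverse`). A right inverse of L agrees
with K up to an exact term, by associativity up to a triple product
(`IsHomotopy.exists_twoSided_inverse`).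

The coefficients in `m₁` and `m₂` are extracted by a representation of the m-copy in which only
generators at positions (i, i+1) survive. There Φ becomes an upper triangular matrix whose entries
are the augmentations, the derivations and their cup product (`mapMatrix_Φ`). -/

noncomputable section

open SFAlg MAlg

/-! ### Words and induction in semi-free algebras -/

namespace SFAlg

variable {R T : Type}

/-- The element of the semi-free algebra given by a word. -/
def word (w : SFMonoid R T) : SFAlg R T := MonoidAlgebra.of ℤ (SFMonoid R T) w

theorem word_mul (v w : SFMonoid R T) : (word (v * w) : SFAlg R T) = word v * word w :=
  map_mul (MonoidAlgebra.of ℤ (SFMonoid R T)) v w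

theorem word_one : (word 1 : SFAlg R T) = 1 := map_one (MonoidAlgebra.of ℤ (SFMonoid R T))

theorem word_inl (a : R) : (word (.inl (.of a)) : SFAlg R T) = gen a := rfl

theorem word_inr (t : T) : (word (.inr (.of t)) : SFAlg R T) = (tUnit t).val := rfl

theorem word_inr_inv (t : T) :
    (word (.inr (.of t)⁻¹) : SFAlg R T) = ((tUnit t)⁻¹ : (SFAlg R T)ˣ).val := rfl

/-- Induction on words, letter by letter from the left. -/
theorem word_induction {p : SFMonoid R T → Prop} (one : p 1)
    (gen : ∀ a w, p w → p (.inl (.of a) * w)) (t : ∀ t w, p w → p (.inr (.of t) * w))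
    (tinv : ∀ t w, p w → p (.inr (.of t)⁻¹ * w)) (w : SFMonoid R T) : p w := by
  -- With a right factor carried along, the property is inherited by products v * v', so the
  -- induction on the free product closes.
  suffices h : ∀ v : SFMonoid R T, ∀ w, p w → p (v * w) by simpa using h w 1 one
  intro v
  induction v using Monoid.Coprod.induction_on with
  | inl m =>
    induction m using FreeMonoid.recOn with
    | one => simp
    | of_mul a m ih =>
      intro w hw
      rw [map_mul, mul_assoc]
      exact gen a _ (ih w hw)
  | inr n =>
    induction n using FreeGroup.induction_on with
    | C1 => simp
    | of x => exact t x
    | inv_of x _ => exact tinv x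
    | mul x y hx hy => intro w hw; rw [map_mul, mul_assoc]; exact hx _ (hy _ hw)
  | mul x y hx hy => intro w hw; rw [mul_assoc]; exact hx _ (hy _ hw)

/-- An additive map vanishes on an element if it vanishes on the words of its support. -/
theorem map_eq_zero_of_support {M : Type*} [AddCommGroup M] (F : SFAlg R T →+ M) (x : SFAlg R T)
    (h : ∀ w ∈ x.coeff.support, F (word w) = 0) : F x = 0 := by
  rw [← MonoidAlgebra.sum_coeff_single x]
  rw [Finsupp.sum, map_sum]
  refine Finset.sum_eq_zero fun w hw => ?_
  have : (MonoidAlgebra.single w (x.coeff w) : SFAlg R T) = x.coeff w • word w := by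
    simp [word]
  rw [this, map_zsmul, h w hw, smul_zero]

/-- Induction on the elements of the semi-free algebra. -/
theorem induction {p : SFAlg R T → Prop} (one : p 1) (gen : ∀ a, p (gen a))
    (t : ∀ t, p (tUnit t : (SFAlg R T)ˣ).val)
    (tinv : ∀ t, p ((tUnit t)⁻¹ : (SFAlg R T)ˣ).val)
    (add : ∀ x y, p x → p y → p (x + y)) (neg : ∀ x, p x → p (-x))
    (mul : ∀ x y, p x → p y → p (x * y)) (x : SFAlg R T) : p x := by
  have hw : ∀ w : SFMonoid R T, p (word w) := by
    intro w
    induction w using word_induction with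
    | one => rwa [word_one]
    | gen a w ih => rw [word_mul]; exact mul _ _ (gen a) ih
    | t t' w ih => rw [word_mul]; exact mul _ _ (t t') ih
    | tinv t' w ih => rw [word_mul]; exact mul _ _ (tinv t') ih
  have zero : p 0 := by simpa using add _ _ one (neg _ one)
  rw [← MonoidAlgebra.sum_coeff_single x]
  refine Finset.sum_induction _ p add zero fun w _ => ?_
  have : (MonoidAlgebra.single w (x.coeff w) : SFAlg R T) = x.coeff w • word w := by
    simp [word]
  rw [this]
  induction x.coeff w using Int.induction_on with
  | zero => simpa using zero
  | succ n ih => rw [add_smul, one_smul]; exact add _ _ ih (hw w)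
  | pred n ih => rw [sub_smul, one_smul, sub_eq_add_neg]; exact add _ _ ih (neg _ (hw w))

theorem lift_gen {B : Type*} [Ring B] (f : R → B) (τ : T → Bˣ) (a : R) :
    lift f τ (gen a) = f a := by
  simp [lift, gen]

theorem map_lift_tUnit {B : Type*} [Ring B] (f : R → B) (τ : T → Bˣ) (t : T) :
    Units.map (lift f τ).toMonoidHom (tUnit t) = τ t := by
  ext
  simp [lift, tUnit]

theorem lift_tUnit {B : Type*} [Ring B] (f : R → B) (τ : T → Bˣ) (t : T) :
    lift f τ (tUnit t).val = (τ t).val :=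
  congrArg Units.val (map_lift_tUnit f τ t)

theorem lift_tUnit_inv {B : Type*} [Ring B] (f : R → B) (τ : T → Bˣ) (t : T) :
    lift f τ ((tUnit t)⁻¹ : (SFAlg R T)ˣ).val = ((τ t)⁻¹ : Bˣ).val := by
  rw [← map_lift_tUnit f τ t]; rfl

theorem ringHom_tUnit_inv {B : Type*} [Ring B] (F G : SFAlg R T →+* B) (t : T)
    (h : F (tUnit t).val = G (tUnit t).val) :
    F ((tUnit t)⁻¹ : (SFAlg R T)ˣ).val = G ((tUnit t)⁻¹ : (SFAlg R T)ˣ).val := by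
  have h1 : Units.map F.toMonoidHom (tUnit t) = Units.map G.toMonoidHom (tUnit t) := Units.ext h
  exact congrArg (fun u : Bˣ => (u⁻¹ : Bˣ).val) h1

/-- Ring homomorphisms agreeing on the generators are equal. -/
theorem ringHom_ext {B : Type*} [Ring B] {F G : SFAlg R T →+* B} (h : ∀ a, F (gen a) = G (gen a))
    (ht : ∀ t, F (tUnit t).val = G (tUnit t).val) : F = G := by
  refine RingHom.ext fun x => ?_
  induction x using SFAlg.induction with
  | one => simp
  | gen a => exact h a
  | t t => exact ht t
  | tinv t => exact ringHom_tUnit_inv F G t (ht t)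
  | add x y hx hy => rw [map_add, map_add, hx, hy]
  | neg x hx => rw [map_neg, map_neg, hx]
  | mul x y hx hy => rw [map_mul, map_mul, hx, hy]

/-! ### Derivations and pairings along ring homomorphisms -/

/-- `D` is a derivation for the bimodule structure given by the ring homomorphisms `P` and `Q`. -/
def IsDer {S : Type*} [Ring S] (P Q : SFAlg R T →+* S) (D : SFAlg R T →+ S) : Prop :=
  ∀ x y, D (x * y) = D x * Q y + P x * D y

/-- `H` has the cup product of `D` and `E` as its defect from being a `(P, Q)`-derivation. -/
def IsPairing {S : Type*} [Ring S] (P Q : SFAlg R T →+* S) (D E H : SFAlg R T →+ S) : Prop :=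
  ∀ x y, H (x * y) = H x * Q y + D x * E y + P x * H y

section Ring

variable {S : Type*} [Ring S] {P Q : SFAlg R T →+* S} {D E H : SFAlg R T →+ S}

theorem IsPairing.map_one (hD : D 1 = 0) (h : IsPairing P Q D E H) : H 1 = 0 := by
  have := h 1 1
  simpa [hD] using this

/-- A derivation is a pairing with vanishing cup product term; facts on pairings thereby specialize
to derivations. -/
theorem IsDer.isPairing (h : IsDer P Q D) (E : SFAlg R T →+ S) : IsPairing P Q 0 E D := by
  intro x y; simp [h x y]

theorem IsDer.map_one (h : IsDer P Q D) : D 1 = 0 := (h.isPairing 0).map_one rfl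

theorem IsDer.neg (h : IsDer P Q D) : IsDer P Q (-D) := by
  intro x y; simp [h x y]; abel

/-- A pairing that vanishes on the invertible generators vanishes on their inverses. -/
theorem IsPairing.map_tUnit_inv (h : IsPairing P Q D E H) (hD1 : D 1 = 0) (t : T)
    (hD : D (tUnit t).val = 0) (hH : H (tUnit t).val = 0) :
    H ((tUnit t)⁻¹ : (SFAlg R T)ˣ).val = 0 := by
  have h1 := h (tUnit t).val ((tUnit t)⁻¹ : (SFAlg R T)ˣ).val
  rw [Units.mul_inv, h.map_one hD1, hH, hD, zero_mul, zero_mul, zero_add, zero_add] at h1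
  -- Expanding H(t t⁻¹) = 0 has left P(t) H(t⁻¹) = 0, and P(t) is invertible.
  have h2 : P ((tUnit t)⁻¹ : (SFAlg R T)ˣ).val * P (tUnit t).val = 1 := by
    rw [← map_mul, Units.inv_mul, _root_.map_one]
  rw [← one_mul (H _), ← h2, mul_assoc, ← h1, mul_zero]

theorem IsDer.map_tUnit_inv (h : IsDer P Q D) (t : T) (hD : D (tUnit t).val = 0) :
    D ((tUnit t)⁻¹ : (SFAlg R T)ˣ).val = 0 :=
  (h.isPairing 0).map_tUnit_inv rfl t rfl hD

theorem IsDer.eq_zero (h : IsDer P Q D) (hg : ∀ a, D (gen a) = 0)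
    (ht : ∀ t, D (tUnit t).val = 0) (x : SFAlg R T) : D x = 0 := by
  induction x using SFAlg.induction with
  | one => exact h.map_one
  | gen a => exact hg a
  | t t => exact ht t
  | tinv t => exact h.map_tUnit_inv t (ht t)
  | add x y hx hy => rw [map_add, hx, hy, add_zero]
  | neg x hx => rw [map_neg, hx, neg_zero]
  | mul x y hx hy => rw [h, hx, hy, zero_mul, mul_zero, add_zero]

/-- Two pairings with the same cup product term differ by a derivation, which is determined on
generators. -/
theorem IsPairing.ext {H' : SFAlg R T →+ S} (h : IsPairing P Q D E H) (h' : IsPairing P Q D E H')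
    (hg : ∀ a, H (gen a) = H' (gen a)) (ht : ∀ t, H (tUnit t).val = H' (tUnit t).val) : H = H' := by
  have hd : IsDer P Q (H - H') := by
    intro x y
    simp only [AddMonoidHom.sub_apply, h x y, h' x y, sub_mul, mul_sub]
    abel
  refine AddMonoidHom.ext fun x => sub_eq_zero.1 (hd.eq_zero (fun a => ?_) (fun t => ?_) x)
  · simp [hg]
  · simp [ht]

theorem IsDer.ext {D' : SFAlg R T →+ S} (h : IsDer P Q D) (h' : IsDer P Q D')
    (hg : ∀ a, D (gen a) = D' (gen a)) (ht : ∀ t, D (tUnit t).val = D' (tUnit t).val) : D = D' :=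
  (h.isPairing 0).ext (h'.isPairing 0) hg ht

/-- The invertible upper triangular matrix with diagonal entries `p` and `q`. -/
def upperUnit (p q : Sˣ) (δ : S) : (Matrix (Fin 2) (Fin 2) S)ˣ where
  val := !![p.val, δ; 0, q.val]
  inv := !![(p⁻¹ : Sˣ).val, -((p⁻¹ : Sˣ).val * δ * (q⁻¹ : Sˣ).val); 0, (q⁻¹ : Sˣ).val]
  val_inv := by
    ext i j; fin_cases i <;> fin_cases j <;> simp [Matrix.mul_apply, ← mul_assoc]
  inv_val := by
    ext i j; fin_cases i <;> fin_cases j <;> simp [Matrix.mul_apply, mul_assoc]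

/-- There is a derivation with prescribed values on the generators. -/
theorem exists_isDer (P Q : SFAlg R T →+* S) (f : R → S) (τ : T → S) :
    ∃ D : SFAlg R T →+ S, IsDer P Q D ∧ (∀ a, D (gen a) = f a) ∧ ∀ t, D (tUnit t).val = τ t := by
  -- A (P, Q)-derivation is the corner of a ring homomorphism to upper triangular matrices with
  -- diagonal P, Q, and freeness supplies the latter.
  let Θ : SFAlg R T →+* Matrix (Fin 2) (Fin 2) S :=
    lift (fun a => !![P (gen a), f a; 0, Q (gen a)]) fun t =>
      upperUnit (Units.map P.toMonoidHom (tUnit t)) (Units.map Q.toMonoidHom (tUnit t)) (τ t)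
  have key : ∀ x, Θ x 0 0 = P x ∧ Θ x 1 1 = Q x ∧ Θ x 1 0 = 0 := by
    intro x
    induction x using SFAlg.induction with
    | one => simp
    | gen a => simp [Θ, lift_gen]
    | t t => simp [Θ, lift_tUnit, upperUnit]
    | tinv t =>
      simp only [Θ, lift_tUnit_inv]
      exact ⟨rfl, rfl, rfl⟩
    | add x y hx hy => simp [hx, hy]
    | neg x hx => simp [hx]
    | mul x y hx hy => simp [Matrix.mul_apply, hx, hy]
  refine ⟨⟨⟨fun x => Θ x 0 1, by simp⟩, fun x y => by simp⟩, fun x y => ?_, fun a => ?_, fun t => ?_⟩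
  · change Θ (x * y) 0 1 = Θ x 0 1 * Q y + P x * Θ y 0 1
    rw [map_mul, Matrix.mul_apply, Fin.sum_univ_two, (key x).1, (key y).2.1, add_comm]
  · simp [Θ, lift_gen]
  · simp [Θ, lift_tUnit, upperUnit]

/-- The ring homomorphism to upper triangular matrices given by a derivation. -/
def IsDer.toMatrix (h : IsDer P Q D) : SFAlg R T →+* Matrix (Fin 2) (Fin 2) S where
  toFun x := !![P x, D x; 0, Q x]
  map_one' := by rw [h.map_one]; simp [Matrix.one_fin_two]
  map_zero' := by ext i j; fin_cases i <;> fin_cases j <;> simp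
  map_add' x y := by simp
  map_mul' x y := by
    ext i j
    fin_cases i <;> fin_cases j <;> simp [Matrix.mul_apply, h x y, add_comm]

end Ring

/-! ### Cup products and triple products of derivations -/

section Pairing

variable {S : Type*} [Ring S] {e₁ e₂ e₃ e₄ : SFAlg R T →+* S} {K₁ K₂ K₃ : SFAlg R T →+ S}

/-- Two derivations have a pairing with prescribed values on the generators. -/
theorem exists_isPairing (h₁ : IsDer e₁ e₂ K₁) (h₂ : IsDer e₂ e₃ K₂) (f : R → S) (τ : T → S) :
    ∃ H : SFAlg R T →+ S, IsPairing e₁ e₃ K₁ K₂ H ∧ (∀ a, H (gen a) = f a) ∧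
      ∀ t, H (tUnit t).val = τ t := by
  -- The triangular trick is iterated with matrix coefficients: in the first column of D, the lower
  -- entry is forced to be K₂, and the entry K₁ of the left action then makes the upper entry a
  -- pairing.
  obtain ⟨D, hD, hg, ht⟩ := exists_isDer h₁.toMatrix
    (show IsDer e₃ e₃ (0 : SFAlg R T →+ S) from fun x y => by simp).toMatrix
    (fun a => !![f a, 0; K₂ (gen a), 0]) (fun t => !![τ t, 0; K₂ (tUnit t).val, 0])
  have hx : ∀ x y i j, D (x * y) i j = (D x * !![e₃ y, 0; 0, e₃ y] + !![e₁ x, K₁ x; 0, e₂ x] * D y) i j :=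
    fun x y i j => by rw [hD x y]; rfl
  let D₁ : SFAlg R T →+ S := ⟨⟨fun x => D x 1 0, by simp⟩, fun x y => by simp⟩
  have e : D₁ = K₂ := by
    refine IsDer.ext (P := e₂) (Q := e₃) (fun x y => ?_) h₂ (fun a => ?_) (fun t => ?_)
    · change D (x * y) 1 0 = D x 1 0 * e₃ y + e₂ x * D y 1 0
      rw [hx]; simp [Matrix.mul_apply, -Matrix.cons_mul]
    · simp [D₁, hg]
    · simp [D₁, ht]
  refine ⟨⟨⟨fun x => D x 0 0, by simp⟩, fun x y => by simp⟩, fun x y => ?_, fun a => ?_, fun t => ?_⟩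
  · change D (x * y) 0 0 = D x 0 0 * e₃ y + K₁ x * K₂ y + e₁ x * D y 0 0
    rw [hx, ← e]; simp [Matrix.mul_apply, -Matrix.cons_mul, D₁]; abel
  · simp [hg]
  · simp [ht]

/-- Pairings of three derivations extend to a triple pairing that vanishes on the generators. -/
theorem exists_triple {H₁₂ H₂₃ : SFAlg R T →+ S} (h₁ : IsDer e₁ e₂ K₁) (h₂ : IsDer e₂ e₃ K₂)
    (h₃ : IsDer e₃ e₄ K₃) (h₁₂ : IsPairing e₁ e₃ K₁ K₂ H₁₂) (h₂₃ : IsPairing e₂ e₄ K₂ K₃ H₂₃) :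
    ∃ G : SFAlg R T →+ S,
      (∀ x y, G (x * y) = G x * e₄ y + H₁₂ x * K₃ y + K₁ x * H₂₃ y + e₁ x * G y) ∧
      (∀ a, G (gen a) = 0) ∧ ∀ t, G (tUnit t).val = 0 := by
  -- The entries of D are H₁₂ and H₂₃ on the diagonal, K₂ below it, and the wanted triple product
  -- above it.
  obtain ⟨D, hD, hg, ht⟩ := exists_isDer h₁.toMatrix h₃.toMatrix
    (fun a => !![H₁₂ (gen a), 0; K₂ (gen a), H₂₃ (gen a)])
    (fun t => !![H₁₂ (tUnit t).val, 0; K₂ (tUnit t).val, H₂₃ (tUnit t).val])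
  have hx : ∀ x y i j, D (x * y) i j =
      (D x * !![e₃ y, K₃ y; 0, e₄ y] + !![e₁ x, K₁ x; 0, e₂ x] * D y) i j :=
    fun x y i j => by rw [hD x y]; rfl
  let c (i j : Fin 2) : SFAlg R T →+ S := ⟨⟨fun x => D x i j, by simp⟩, fun x y => by simp⟩
  have e : c 1 0 = K₂ := by
    refine IsDer.ext (P := e₂) (Q := e₃) (fun x y => ?_) h₂ (fun a => ?_) (fun t => ?_)
    · change D (x * y) 1 0 = D x 1 0 * e₃ y + e₂ x * D y 1 0
      rw [hx]; simp [Matrix.mul_apply, -Matrix.cons_mul]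
    · simp [c, hg]
    · simp [c, ht]
  have hc : ∀ x, D x 1 0 = K₂ x := fun x => DFunLike.congr_fun e x
  have e₁₂ : c 0 0 = H₁₂ := by
    refine IsPairing.ext (P := e₁) (Q := e₃) (D := K₁) (E := K₂) (fun x y => ?_) h₁₂
      (fun a => ?_) (fun t => ?_)
    · change D (x * y) 0 0 = D x 0 0 * e₃ y + K₁ x * K₂ y + e₁ x * D y 0 0
      rw [hx, ← hc]; simp [Matrix.mul_apply, -Matrix.cons_mul]; abel
    · simp [c, hg]
    · simp [c, ht]
  have e₂₃ : c 1 1 = H₂₃ := by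
    refine IsPairing.ext (P := e₂) (Q := e₄) (D := K₂) (E := K₃) (fun x y => ?_) h₂₃
      (fun a => ?_) (fun t => ?_)
    · change D (x * y) 1 1 = D x 1 1 * e₄ y + K₂ x * K₃ y + e₂ x * D y 1 1
      rw [hx, ← hc]; simp [Matrix.mul_apply, -Matrix.cons_mul]; abel
    · simp [c, hg]
    · simp [c, ht]
  refine ⟨c 0 1, fun x y => ?_, fun a => by simp [c, hg], fun t => by simp [c, ht]⟩
  rw [← e₁₂, ← e₂₃]
  change D (x * y) 0 1 = D x 0 1 * e₄ y + D x 0 0 * K₃ y + K₁ x * D y 1 1 + e₁ x * D y 0 1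
  rw [hx]; simp [Matrix.mul_apply, -Matrix.cons_mul]; abel

end Pairing

/-! ### Heights of words -/

/-- The height of a word is the sum of the heights of its letters; the letters `t` have height `0`. -/
def wordHeight (h : R → ℝ) : SFMonoid R T →* Multiplicative ℝ :=
  Monoid.Coprod.lift (FreeMonoid.lift fun a => Multiplicative.ofAdd (h a)) 1

/-- A pairing that vanishes on the generators vanishes on a word if the second derivation
vanishes on all generators that can follow another one in the word. -/
theorem IsPairing.eq_zero_of_wordHeight {S : Type*} [Ring S] {P P' Q : SFAlg R T →+* S}
    {D E H : SFAlg R T →+ S} {h : R → ℝ} (h0 : ∀ a, 0 < h a) (hH : IsPairing P Q D E H)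
    (hD : IsDer P P' D) (hE : IsDer P' Q E) (hDt : ∀ t, D (tUnit t).val = 0)
    (hEt : ∀ t, E (tUnit t).val = 0) (hHt : ∀ t, H (tUnit t).val = 0)
    (hHg : ∀ a, H (gen a) = 0) {c : ℝ} (hEg : ∀ b, h b < c → E (gen b) = 0)
    (w : SFMonoid R T) (hw : (wordHeight h w).toAdd ≤ c) : H (word w) = 0 := by
  have hgen : ∀ (a : R) (w : SFMonoid R T), (wordHeight h (.inl (.of a) * w)).toAdd =
      h a + (wordHeight h w).toAdd := by
    intro a w; simp [wordHeight]
  have htt : ∀ (g : FreeGroup T) (w : SFMonoid R T), (wordHeight h (.inr g * w)).toAdd =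
      (wordHeight h w).toAdd := by
    intro a w; simp [wordHeight]
  have hpos : ∀ w : SFMonoid R T, 0 ≤ (wordHeight h w).toAdd := by
    intro w
    induction w using word_induction with
    | one => simp
    | gen a w ih => rw [hgen]; linarith [h0 a]
    | t t w ih => rwa [htt]
    | tinv t w ih => rwa [htt]
  have hEw : ∀ w : SFMonoid R T, (wordHeight h w).toAdd < c → E (word w) = 0 := by
    intro w
    induction w using word_induction with
    | one => intro _; rw [word_one, hE.map_one]
    | gen a w ih =>
      intro hc
      rw [hgen] at hc
      rw [word_mul, hE, ih (by linarith [h0 a]), word_inl, hEg a (by linarith [hpos w])]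
      simp
    | t t w ih =>
      intro hc
      rw [htt] at hc
      rw [word_mul, hE, ih hc, word_inr, hEt]; simp
    | tinv t w ih =>
      intro hc
      rw [htt] at hc
      rw [word_mul, hE, ih hc, word_inr_inv, hE.map_tUnit_inv t (hEt t)]; simp
  induction w using word_induction with
  | one => rw [word_one, hH.map_one hD.map_one]
  | gen a w ih =>
    rw [hgen] at hw
    -- In the term D(a) E(w), the tail w has height at most c - h(a) < c, so E kills it; the weak
    -- bound on the whole word suffices.
    rw [word_mul, hH, ih (by linarith [h0 a]), word_inl, hHg, hEw w (by linarith [h0 a])]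
    simp
  | t t w ih =>
    rw [htt] at hw
    rw [word_mul, hH, ih hw, word_inr, hHt, hDt]; simp
  | tinv t w ih =>
    rw [htt] at hw
    rw [word_mul, hH, ih hw, word_inr_inv, hH.map_tUnit_inv hD.map_one t (hDt t) (hHt t),
      hD.map_tUnit_inv t (hDt t)]
    simp

end SFAlg

/-! ### Degrees of maps on semi-free algebras -/

/-- Reduction modulo 2 is defined on `ZMod (2 * ρ)`, also for ρ = 0 where this is ℤ, so parity makes
sense. -/
theorem ZMod.not_even_neg_one (ρ : ℕ) : ¬ Even (-1 : ZMod (2 * ρ)) := by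
  rintro ⟨j, hj⟩
  have h := congrArg (ZMod.castHom (Dvd.intro ρ rfl : 2 ∣ 2 * ρ) (ZMod 2)) hj
  rw [map_add, map_neg, map_one, CharTwo.add_self_eq_zero] at h
  exact absurd h (by decide)

theorem ZMod.one_ne_zero_two_mul (ρ : ℕ) : (1 : ZMod (2 * ρ)) ≠ 0 := by
  intro h
  exact ZMod.not_even_neg_one ρ (by rw [h, neg_zero]; exact Even.zero)

namespace SFAlg

variable {R T : Type} {n : ℕ} {deg : R → ZMod n}

theorem degSign_zero : degSign (0 : ZMod n) = 1 := if_pos Even.zero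

theorem degSign_neg_one (ρ : ℕ) : degSign (-1 : ZMod (2 * ρ)) = -1 :=
  if_neg (ZMod.not_even_neg_one ρ)

theorem wordDegree_gen_mul (a : R) (w : SFMonoid R T) :
    (wordDegree deg (.inl (.of a) * w)).toAdd = deg a + (wordDegree deg w).toAdd := by
  simp [wordDegree]

theorem wordDegree_inr_mul (g : FreeGroup T) (w : SFMonoid R T) :
    (wordDegree deg (.inr g * w)).toAdd = (wordDegree deg w).toAdd := by
  simp [wordDegree]

theorem isHomogeneous_word (w : SFMonoid R T) :
    IsHomogeneous deg (wordDegree deg w).toAdd (word w) := by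
  intro v hv
  have : v = w := by
    simpa [word, MonoidAlgebra.of] using hv
  rw [this]; rfl

theorem isHomogeneous_gen (a : R) : IsHomogeneous deg (deg a) (gen a : SFAlg R T) := by
  have := isHomogeneous_word (deg := deg) (T := T) (.inl (.of a))
  simpa [wordDegree, word_inl] using this

theorem isHomogeneous_tUnit (t : T) : IsHomogeneous deg 0 (tUnit t : (SFAlg R T)ˣ).val := by
  have := isHomogeneous_word (deg := deg) (R := R) (.inr (.of t))
  simpa [wordDegree, word_inr] using this

/-- The map `F` vanishes on all homogeneous elements of degree different from `i`. -/
def HasDegree {M : Type*} [Zero M] (deg : R → ZMod n) (i : ZMod n) (F : SFAlg R T → M) : Prop :=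
  ∀ j x, j ≠ i → IsHomogeneous deg j x → F x = 0

theorem hasDegree_of_word {M : Type*} [AddCommGroup M] {i : ZMod n} (F : SFAlg R T →+ M)
    (h : ∀ w, (wordDegree deg w).toAdd ≠ i → F (word w) = 0) : HasDegree deg i F := by
  intro j x hj hx
  refine map_eq_zero_of_support F x fun w hw => h w ?_
  rwa [hx w hw]

theorem HasDegree.word_eq_zero {M : Type*} [Zero M] {i : ZMod n} {F : SFAlg R T → M}
    (hF : HasDegree deg i F) (w : SFMonoid R T) (h : (wordDegree deg w).toAdd ≠ i) :
    F (word w) = 0 :=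
  hF _ _ h (isHomogeneous_word w)

/-- Induction on the word: in each of the three terms the degrees of the factors would have to add
up to i + j, so otherwise one factor vanishes. Since D need not be a derivation, its vanishing on
inverses is a separate hypothesis. -/
theorem IsPairing.hasDegree {S : Type*} [Ring S] {P Q : SFAlg R T →+* S}
    {D E H : SFAlg R T →+ S} {i j : ZMod n} (h : IsPairing P Q D E H) (hP : HasDegree deg 0 P)
    (hQ : HasDegree deg 0 Q) (hD : HasDegree deg i D) (hE : HasDegree deg j E) (hD1 : D 1 = 0)
    (hDt : ∀ t, D (tUnit t).val = 0) (hDt' : ∀ t, D ((tUnit t)⁻¹ : (SFAlg R T)ˣ).val = 0)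
    (hHt : ∀ t, H (tUnit t).val = 0) (hH : ∀ a, deg a ≠ i + j → H (gen a) = 0) :
    HasDegree deg (i + j) H := by
  refine hasDegree_of_word H fun w => ?_
  induction w using word_induction with
  | one => intro _; rw [word_one, h.map_one hD1]
  | gen a w ih =>
    rw [wordDegree_gen_mul]
    intro hw
    rw [word_mul, h, word_inl]
    have h1 : H (gen a) * Q (word w) = 0 := by
      by_cases ha : deg a = i + j
      · rw [hQ.word_eq_zero w (fun h0 => hw (by rw [ha, h0, add_zero])), mul_zero]
      · rw [hH a ha, zero_mul]
    have h2 : D (gen a) * E (word w) = 0 := by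
      by_cases ha : deg a = i
      · rw [hE.word_eq_zero w (fun h0 => hw (by rw [ha, h0])), mul_zero]
      · rw [hD _ _ ha (isHomogeneous_gen a), zero_mul]
    have h3 : P (gen a) * H (word w) = 0 := by
      by_cases ha : deg a = 0
      · rw [ih (fun h0 => hw (by rw [ha, h0, zero_add])), mul_zero]
      · rw [hP _ _ ha (isHomogeneous_gen a), zero_mul]
    rw [h1, h2, h3]; simp
  | t t w ih =>
    rw [wordDegree_inr_mul]
    intro hw
    rw [word_mul, h, word_inr, hDt, hHt, ih hw]; simp
  | tinv t w ih =>
    rw [wordDegree_inr_mul]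
    intro hw
    rw [word_mul, h, word_inr_inv, hDt', h.map_tUnit_inv hD1 t (hDt t) (hHt t), ih hw]; simp

theorem IsDer.hasDegree {S : Type*} [Ring S] {P Q : SFAlg R T →+* S}
    {D : SFAlg R T →+ S} {i : ZMod n} (h : IsDer P Q D) (hP : HasDegree deg 0 P)
    (hQ : HasDegree deg 0 Q) (hDt : ∀ t, D (tUnit t).val = 0)
    (hD : ∀ a, deg a ≠ i → D (gen a) = 0) : HasDegree deg i D := by
  have := (h.isPairing 0).hasDegree (i := 0) (j := i) hP hQ (fun _ _ _ _ => rfl)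
    (fun _ _ _ _ => rfl) rfl (fun _ => rfl) (fun _ => rfl) hDt (by simpa using hD)
  rwa [zero_add] at this

theorem signHom_gen (a : R) : (signHom deg (gen a) : SFAlg R T) = degSign (deg a) • gen a :=
  lift_gen _ _ a

theorem signHom_tUnit (t : T) : (signHom deg (tUnit t).val : SFAlg R T) = (tUnit t).val :=
  lift_tUnit _ _ t

theorem HasDegree.apply_signHom_gen {M : Type*} [AddCommGroup M] {i : ZMod n}
    {F : SFAlg R T →+ M} (hF : HasDegree deg i F) (a : R) :
    F (signHom deg (gen a)) = degSign i • F (gen a) := by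
  rw [signHom_gen, map_zsmul]
  by_cases ha : deg a = i
  · rw [ha]
  · rw [hF _ _ ha (isHomogeneous_gen a), smul_zero, smul_zero]

end SFAlg

/-! ### Homotopies of augmentations -/

section Homotopy

variable {ρ : ℕ} {R : Type} {𝓐 : SemiFreeDGA ρ R Unit} {k : Type*} [CommRing k]
  {ε₁ ε₂ ε₃ : Augmentation 𝓐 k}

theorem Augmentation.hasDegree {T : Type} {𝓐 : SemiFreeDGA ρ R T} (ε : Augmentation 𝓐 k) :
    HasDegree 𝓐.deg 0 ε.toRingHom :=
  ε.map_of_degree_ne_zero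

/-- Augmentations live in degree 0, which is even. This removes the sign from the Leibniz rule of a
homotopy. -/
theorem Augmentation.map_signHom {T : Type} {𝓐 : SemiFreeDGA ρ R T} (ε : Augmentation 𝓐 k)
    (x : SFAlg R T) : ε.toRingHom (signHom 𝓐.deg x) = ε.toRingHom x := by
  refine RingHom.congr_fun (f := ε.toRingHom.comp (signHom 𝓐.deg)) (ringHom_ext ?_ ?_) x
  · intro a
    have := HasDegree.apply_signHom_gen (F := ε.toRingHom.toAddMonoidHom) ε.hasDegree a
    rw [degSign_zero, one_smul] at this
    exact this
  · intro t; simp [signHom_tUnit]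

/-- `K` is an `(ε₁, ε₂)`-derivation of degree `+1`. -/
structure IsDegreeOneDer (ε₁ ε₂ : Augmentation 𝓐 k) (K : SFAlg R Unit →+ k) : Prop where
  isDer : IsDer ε₁.toRingHom ε₂.toRingHom K
  hasDegree : HasDegree 𝓐.deg (-1) K

/-- `K` is a homotopy from `ε₁` to `ε₂`. -/
structure IsHomotopy (ε₁ ε₂ : Augmentation 𝓐 k) (K : SFAlg R Unit →+ k) : Prop
    extends IsDegreeOneDer ε₁ ε₂ K where
  sub_eq : ∀ x, ε₁.toRingHom x - ε₂.toRingHom x = K (𝓐.d x)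

theorem dgaHomotopic_iff : DGAHomotopic ε₁ ε₂ ↔ ∃ K, IsHomotopy ε₁ ε₂ K := by
  -- The target sits in degree 0, so a map of degree +1 is supported on elements of degree -1.
  have h1 : ∀ i : ZMod (2 * ρ), i + 1 ≠ 0 ↔ i ≠ -1 := fun i => by
    rw [Ne, Ne, eq_neg_iff_add_eq_zero]
  constructor
  · rintro ⟨K, hd, hs, hm⟩
    exact ⟨K, ⟨fun x y => by rw [hm, ε₁.map_signHom], fun i x hi => hd i x ((h1 i).2 hi)⟩, hs⟩
  · rintro ⟨K, ⟨hm, hd⟩, hs⟩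
    exact ⟨K, fun i x hi => hd i x ((h1 i).1 hi), hs, fun x y => by rw [hm, ε₁.map_signHom]⟩

/-! ### Derivations of degree one -/

namespace IsDegreeOneDer

variable {K K₁ K₂ : SFAlg R Unit →+ k}

/-- The degree 0 of t differs from -1 for every ρ. Hence K is determined by the chords, and
homotopic augmentations agree on t. -/
theorem map_tUnit (h : IsDegreeOneDer ε₁ ε₂ K) (t : Unit) : K (tUnit t).val = 0 := by
  refine h.hasDegree 0 _ ?_ (isHomogeneous_tUnit t)
  intro h0
  exact ZMod.one_ne_zero_two_mul ρ (by rw [← neg_eq_zero, ← h0])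

theorem map_tUnit_inv (h : IsDegreeOneDer ε₁ ε₂ K) (t : Unit) :
    K ((tUnit t)⁻¹ : (SFAlg R Unit)ˣ).val = 0 :=
  h.isDer.map_tUnit_inv t (h.map_tUnit t)

theorem map_signHom (h : IsDegreeOneDer ε₁ ε₂ K) (x : SFAlg R Unit) :
    K (signHom 𝓐.deg x) = -K x := by
  refine DFunLike.congr_fun (F := SFAlg R Unit →+ k)
    (f := K.comp (signHom 𝓐.deg).toAddMonoidHom) (g := -K) (IsDer.ext
      (P := ε₁.toRingHom) (Q := ε₂.toRingHom) (fun x y => ?_) h.isDer.neg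
      (fun a => ?_) (fun t => ?_)) x
  · change K (signHom 𝓐.deg (x * y)) = K (signHom 𝓐.deg x) * _ + _ * K (signHom 𝓐.deg y)
    rw [map_mul, h.isDer, ε₁.map_signHom, ε₂.map_signHom]
  · have := h.hasDegree.apply_signHom_gen a
    rw [degSign_neg_one, neg_one_smul] at this
    exact this
  · change K (signHom 𝓐.deg _) = - K _
    rw [signHom_tUnit, h.map_tUnit, neg_zero]

/-- The two signs of the odd maps K₁ and K₂ cancel in the cup product term. -/
theorem pairing_map_signHom (h₁ : IsDegreeOneDer ε₁ ε₂ K₁) (h₂ : IsDegreeOneDer ε₂ ε₃ K₂)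
    {H : SFAlg R Unit →+ k} (h : IsPairing ε₁.toRingHom ε₃.toRingHom K₁ K₂ H)
    (hg : ∀ a, H (gen a) = 0) (x : SFAlg R Unit) :
    H (signHom 𝓐.deg x) = H x := by
  refine DFunLike.congr_fun (F := SFAlg R Unit →+ k)
    (f := H.comp (signHom 𝓐.deg).toAddMonoidHom) (g := H) (IsPairing.ext
      (P := ε₁.toRingHom) (Q := ε₃.toRingHom) (fun x y => ?_) h
      (fun a => ?_) (fun t => ?_)) x
  · change H (signHom 𝓐.deg (x * y)) = H (signHom 𝓐.deg x) * _ + _ + _ * H (signHom 𝓐.deg y)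
    rw [map_mul, h, ε₁.map_signHom, ε₃.map_signHom, h₁.map_signHom, h₂.map_signHom, neg_mul_neg]
  · change H (signHom 𝓐.deg _) = H _
    rw [signHom_gen, map_zsmul, hg, smul_zero]
  · change H (signHom 𝓐.deg _) = H _
    rw [signHom_tUnit]

theorem pairing_hasDegree (h₁ : IsDegreeOneDer ε₁ ε₂ K₁) (h₂ : IsDegreeOneDer ε₂ ε₃ K₂)
    {H : SFAlg R Unit →+ k} (h : IsPairing ε₁.toRingHom ε₃.toRingHom K₁ K₂ H)
    (hg : ∀ a, H (gen a) = 0) (ht : ∀ t, H (tUnit t).val = 0) :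
    HasDegree 𝓐.deg (-1 + -1) H :=
  h.hasDegree ε₁.hasDegree ε₃.hasDegree h₁.hasDegree h₂.hasDegree h₁.isDer.map_one h₁.map_tUnit
    h₁.map_tUnit_inv ht fun a _ => hg a

/-- The defect of `K` from being a homotopy is a derivation. -/
theorem defect_isDer (h : IsDegreeOneDer ε₁ ε₂ K) :
    IsDer ε₁.toRingHom ε₂.toRingHom
      (ε₁.toRingHom.toAddMonoidHom - ε₂.toRingHom.toAddMonoidHom - K.comp 𝓐.d) := by
  intro x y
  change ε₁.toRingHom (x * y) - ε₂.toRingHom (x * y) - K (𝓐.d (x * y)) =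
    (ε₁.toRingHom x - ε₂.toRingHom x - K (𝓐.d x)) * ε₂.toRingHom y +
      ε₁.toRingHom x * (ε₁.toRingHom y - ε₂.toRingHom y - K (𝓐.d y))
  rw [𝓐.d_mul, map_add, h.isDer, h.isDer, ε₂.map_d, ε₁.map_d, ε₁.map_signHom, map_mul, map_mul]
  ring

/-- The defect is a derivation, so the homotopy equation spreads from the generators to the whole
algebra. -/
theorem isHomotopy (h : IsDegreeOneDer ε₁ ε₂ K)
    (hg : ∀ a, ε₁.toRingHom (gen a) - ε₂.toRingHom (gen a) = K (𝓐.d (gen a)))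
    (ht : ∀ t, ε₁.toRingHom (tUnit t).val = ε₂.toRingHom (tUnit t).val) : IsHomotopy ε₁ ε₂ K :=
  ⟨h, fun x => sub_eq_zero.1 <| h.defect_isDer.eq_zero (fun a => sub_eq_zero.2 (hg a))
    (fun t => by
      change ε₁.toRingHom _ - ε₂.toRingHom _ - K (𝓐.d _) = 0
      rw [𝓐.d_t, map_zero, ht, sub_self, sub_zero]) x⟩

/-- A derivation of degree `+1` with prescribed values on the generators. -/
theorem exists_of_gen (ε₁ ε₂ : Augmentation 𝓐 k) (f : R → k)
    (hf : ∀ a, 𝓐.deg a ≠ -1 → f a = 0) :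
    ∃ K, IsDegreeOneDer ε₁ ε₂ K ∧ ∀ a, K (gen a) = f a := by
  obtain ⟨K, hK, hg, ht⟩ := exists_isDer ε₁.toRingHom ε₂.toRingHom f 0
  exact ⟨K, ⟨hK, hK.hasDegree ε₁.hasDegree ε₂.hasDegree (by simpa using ht)
    (fun a ha => by rw [hg, hf a ha])⟩, hg⟩

end IsDegreeOneDer

/-- The height filtration: the words of the differential of `a` have at most the height of `a`. -/
def SemiFreeDGA.IsFiltered (𝓐 : SemiFreeDGA ρ R Unit) (h : R → ℝ) : Prop :=
  (∀ a, 0 < h a) ∧ ∀ a, ∀ w ∈ (𝓐.d (gen a)).coeff.support, (wordHeight h w).toAdd ≤ h a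

/-- A self-map of a product, each coordinate of which depends only on the smaller coordinates, has a
fixed point. -/
theorem exists_fixedPoint_of_wellFounded {ι M : Type*} [Zero M] {r : ι → ι → Prop}
    (hr : WellFounded r) (F : (ι → M) → ι → M)
    (hF : ∀ f g a, (∀ b, r b a → f b = g b) → F f a = F g a) : ∃ f, ∀ a, f a = F f a := by
  classical
  let f : ι → M := hr.fix fun a ih => F (fun b => if hb : r b a then ih b hb else 0) a
  refine ⟨f, fun a => ?_⟩
  change hr.fix _ a = _
  rw [WellFounded.fix_eq]
  refine hF _ _ a fun b hb => ?_
  rw [dif_pos hb]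

theorem wellFounded_height [Finite R] (h : R → ℝ) : WellFounded fun a b => h a < h b :=
  have : IsTrans R fun a b => h a < h b := ⟨fun _ _ _ => lt_trans⟩
  have : Std.Irrefl fun a b : R => h a < h b := ⟨fun a => lt_irrefl (h a)⟩
  Finite.wellFounded_of_trans_of_irrefl _

/-- A homotopy has an inverse from the right. -/
theorem IsHomotopy.exists_inverse [Finite R] {h : R → ℝ} (hA : 𝓐.IsFiltered h)
    {K : SFAlg R Unit →+ k} (hK : IsHomotopy ε₁ ε₂ K) :
    ∃ L H : SFAlg R Unit →+ k, IsHomotopy ε₂ ε₁ L ∧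
      IsPairing ε₁.toRingHom ε₁.toRingHom K L H ∧ (∀ a, H (gen a) = 0) ∧
      (∀ t, H (tUnit t).val = 0) ∧ ∀ x, K x + L x + H (𝓐.d x) = 0 := by
  classical
  have hex : ∀ f : R → k, ∃ L H : SFAlg R Unit →+ k, IsDegreeOneDer ε₂ ε₁ L ∧
      (∀ a, L (gen a) = if 𝓐.deg a = -1 then f a else 0) ∧
      IsPairing ε₁.toRingHom ε₁.toRingHom K L H ∧ (∀ a, H (gen a) = 0) ∧
      (∀ t, H (tUnit t).val = 0) := by
    intro f
    obtain ⟨L, hL, hLg⟩ := IsDegreeOneDer.exists_of_gen ε₂ ε₁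
      (fun a => if 𝓐.deg a = -1 then f a else 0) (fun a ha => if_neg ha)
    obtain ⟨H, hH, hg, ht⟩ := exists_isPairing hK.isDer hL.isDer (fun _ => 0) fun _ => 0
    exact ⟨L, H, hL, hLg, hH, hg, ht⟩
  choose L H hL hLg hH hHg hHt using hex
  -- The equation K + L + H ∘ ∂ = 0 at a chord is read as a recursion for L on the chords.
  obtain ⟨f, hf⟩ := exists_fixedPoint_of_wellFounded (wellFounded_height h)
    (fun f a => -K (gen a) - H f (𝓐.d (gen a))) (by
      intro f g a hfg
      have hHd : IsPairing ε₁.toRingHom ε₁.toRingHom K (L f - L g) (H f - H g) := by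
        intro x y
        simp only [AddMonoidHom.sub_apply, hH f x y, hH g x y]
        ring
      have hLd : IsDer ε₂.toRingHom ε₁.toRingHom (L f - L g) := by
        intro x y
        simp only [AddMonoidHom.sub_apply, (hL f).isDer x y, (hL g).isDer x y]
        ring
      -- The difference is the cup product of K with L f - L g, and the latter vanishes on chords
      -- lower than a: the filtration makes it vanish on ∂a.
      have : (H f - H g) (𝓐.d (gen a)) = 0 := by
        refine map_eq_zero_of_support _ _ fun w hw => ?_
        refine hHd.eq_zero_of_wordHeight hA.1 hK.isDer hLd hK.map_tUnit (fun t => ?_)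
          (fun t => ?_) (fun b => ?_) (c := h a) (fun b hb => ?_) w (hA.2 a w hw)
        · simp [(hL f).map_tUnit, (hL g).map_tUnit]
        · simp [hHt]
        · simp [hHg]
        · simp [hLg, hfg b hb]
      rw [AddMonoidHom.sub_apply, sub_eq_zero] at this
      simp only [this])
  set L' := L f
  set H' := H f
  have hL' := hL f
  have hH' := hH f
  let J : SFAlg R Unit →+ k := K + L' + H'.comp 𝓐.d
  have hJ : ∀ x, J x = K x + L' x + H' (𝓐.d x) := fun x => rfl
  let E : SFAlg R Unit →+ k :=
    ε₂.toRingHom.toAddMonoidHom - ε₁.toRingHom.toAddMonoidHom - L'.comp 𝓐.d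
  have hE : ∀ x, E x = ε₂.toRingHom x - ε₁.toRingHom x - L' (𝓐.d x) := fun x => rfl
  have hEd : IsDer ε₂.toRingHom ε₁.toRingHom E := hL'.defect_isDer
  -- Until L' is known to be a homotopy, its defect E is all that prevents J from being a
  -- derivation.
  have hJp : IsPairing ε₁.toRingHom ε₁.toRingHom K E J := by
    intro x y
    simp only [hJ, hE]
    rw [𝓐.d_mul, map_add, hH', hH', hK.isDer, hL'.isDer, ε₁.map_d, ε₁.map_d, ← hK.sub_eq,
      hK.map_signHom, ε₁.map_signHom]
    ring
  have hJg : ∀ a, J (gen a) = 0 := by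
    intro a
    rw [hJ, hLg]
    split_ifs with ha
    · rw [hf a]; ring
    -- Outside degree -1 the recursion was not imposed; there the terms vanish separately, as H'
    -- lives in degree -2 and ∂ lowers degree by 1.
    · have h1 : K (gen a) = 0 := hK.hasDegree _ _ ha (isHomogeneous_gen a)
      have h2 : H' (𝓐.d (gen a)) = 0 := by
        refine hK.pairing_hasDegree hL' hH' (hHg f) (hHt f) _ _ ?_
          (𝓐.d_degree _ _ (isHomogeneous_gen a))
        rw [sub_eq_add_neg]
        exact fun h => ha (add_right_cancel h)
      rw [h1, h2]; simp
  have hJt : ∀ t, J (tUnit t).val = 0 := by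
    intro t
    rw [hJ, hK.map_tUnit, hL'.map_tUnit, 𝓐.d_t, map_zero, add_zero, add_zero]
  have ht : ∀ t, ε₂.toRingHom (tUnit t).val = ε₁.toRingHom (tUnit t).val := by
    intro t
    have := hK.sub_eq (tUnit t).val
    rw [𝓐.d_t, map_zero, sub_eq_zero] at this
    exact this.symm
  have hEt : ∀ t, E (tUnit t).val = 0 := by
    intro t
    rw [hE, 𝓐.d_t, map_zero, ht, sub_self, sub_zero]
  have hJE : ∀ x, J (𝓐.d x) = -E x := by
    intro x
    rw [hJ, hE, 𝓐.d_d, map_zero, ← hK.sub_eq]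
    ring
  -- E(a) = -J(∂a), and on ∂a the pairing J of K and E involves E only on chords lower than a.
  have hEg : ∀ a, E (gen a) = 0 := by
    intro a
    induction a using (wellFounded_height h).induction with
    | _ a ih =>
      rw [← neg_eq_zero, ← hJE]
      refine map_eq_zero_of_support _ _ fun w hw => ?_
      exact hJp.eq_zero_of_wordHeight hA.1 hK.isDer hEd hK.map_tUnit hEt hJt hJg ih w (hA.2 a w hw)
  have hE0 : ∀ x, E x = 0 := hEd.eq_zero hEg hEt
  have hJd : IsDer ε₁.toRingHom ε₁.toRingHom J := by
    intro x y
    rw [hJp, hE0]; ring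
  refine ⟨L', H', ⟨hL', fun x => sub_eq_zero.1 (hE0 x)⟩, hH', hHg f, hHt f,
    hJd.eq_zero hJg hJt⟩

/-- A homotopy has an inverse from the right, which is an inverse up to homotopy from the left. -/
theorem IsHomotopy.exists_twoSided_inverse [Finite R] {h : R → ℝ} (hA : 𝓐.IsFiltered h)
    {K : SFAlg R Unit →+ k} (hK : IsHomotopy ε₁ ε₂ K) :
    ∃ L H H' Q : SFAlg R Unit →+ k, IsHomotopy ε₂ ε₁ L ∧
      (IsPairing ε₁.toRingHom ε₁.toRingHom K L H ∧ (∀ a, H (gen a) = 0) ∧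
        (∀ t, H (tUnit t).val = 0) ∧ ∀ x, K x + L x + H (𝓐.d x) = 0) ∧
      (IsPairing ε₂.toRingHom ε₂.toRingHom L K H' ∧ (∀ a, H' (gen a) = 0) ∧
        (∀ t, H' (tUnit t).val = 0)) ∧
      IsDer ε₂.toRingHom ε₂.toRingHom Q ∧ (∀ t, Q (tUnit t).val = 0) ∧
      ∀ x, L x + K x + H' (𝓐.d x) = Q (𝓐.d x) := by
  obtain ⟨L, H, hL, hH, hHg, hHt, hKL⟩ := hK.exists_inverse hA
  -- K₂ is a right inverse of L that need not equal K; the remaining work compares the two.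
  obtain ⟨K₂, H₂, hK₂, hH₂, hH₂g, hH₂t, hLK⟩ := hL.exists_inverse hA
  obtain ⟨H', hH', hH'g, hH't⟩ :=
    exists_isPairing hL.isDer hK.isDer (fun _ => 0) fun _ => 0
  obtain ⟨G, hG, -, hGt⟩ := exists_triple hK.isDer hL.isDer hK₂.isDer hH hH₂
  -- Associativity for K, L, K₂: the triple product G corrects the two bracketings, so that M is a
  -- derivation with M ∘ ∂ = K - K₂.
  let M : SFAlg R Unit →+ k := H₂ + G.comp 𝓐.d - H
  have hM : ∀ x, M x = H₂ x + G (𝓐.d x) - H x := fun x => rfl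
  have hMd : IsDer ε₁.toRingHom ε₂.toRingHom M := by
    intro x y
    have e1 : H (𝓐.d x) = -K x - L x := by linear_combination hKL x
    have e2 : H₂ (𝓐.d y) = -L y - K₂ y := by linear_combination hLK y
    simp only [hM]
    rw [𝓐.d_mul, map_add, hG, hG, hH₂, hH, ε₂.map_d, ε₁.map_d, hK.map_signHom,
      hK.toIsDegreeOneDer.pairing_map_signHom hL.toIsDegreeOneDer hH hHg, ε₁.map_signHom,
      ← hK.sub_eq, ← hK₂.sub_eq, e1, e2]
    ring
  have hKM : ∀ x, M (𝓐.d x) = K x - K₂ x := by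
    intro x
    rw [hM, 𝓐.d_d, map_zero]
    linear_combination hLK x - hKL x
  obtain ⟨N, hN, -, hNt⟩ := exists_isPairing hL.isDer hMd (fun _ => 0) fun _ => 0
  -- H' - H₂ is the cup product of L with M ∘ ∂. The term N ∘ ∂ cancels it and replaces ε₁ by ε₂ on
  -- the left of M, which makes Q an (ε₂, ε₂)-derivation.
  let Q : SFAlg R Unit →+ k := M + (H' - H₂) + N.comp 𝓐.d
  have hQ : ∀ x, Q x = M x + (H' x - H₂ x) + N (𝓐.d x) := fun x => rfl
  refine ⟨L, H, H', Q, hL, ⟨hH, hHg, hHt, hKL⟩, ⟨hH', hH'g, hH't⟩, ?_, ?_, ?_⟩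
  · intro x y
    simp only [hQ]
    rw [𝓐.d_mul, map_add, hN, hN, hMd, hH', hH₂, ε₂.map_d, ε₂.map_d, hL.map_signHom,
      ε₂.map_signHom, ← hL.sub_eq, hKM]
    ring
  · intro t
    simp only [hQ, hM]
    rw [𝓐.d_t]
    simp [hH't, hH₂t, hHt]
  · intro x
    rw [hQ, 𝓐.d_d, map_zero, hKM]
    linear_combination hLK x

end Homotopy

/-! ### Matrix representations of the `m`-copy algebras -/

namespace AugPlus

section Block

variable {m : ℕ} {k : Type*} [CommRing k]

/-- The matrix of matrices whose `(i, j)` entry is `N i j` times the elementary matrix `E i j` off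
the diagonal and `N i i` times the identity matrix on the diagonal. -/
def blockMatrix (N : Matrix (Fin m) (Fin m) k) :
    Matrix (Fin m) (Fin m) (Matrix (Fin m) (Fin m) k) :=
  .of fun i j => if i = j then N i j • 1 else Matrix.single i j (N i j)

theorem blockMatrix_apply_self (N : Matrix (Fin m) (Fin m) k) (i j : Fin m) :
    blockMatrix N i j i j = N i j := by
  by_cases h : i = j
  · simp [blockMatrix, h]
  · simp [blockMatrix, h]

theorem blockMatrix_add (N N' : Matrix (Fin m) (Fin m) k) :
    blockMatrix (N + N') = blockMatrix N + blockMatrix N' := by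
  ext1 i j
  by_cases h : i = j
  · simp [blockMatrix, h, add_smul]
  · simp [blockMatrix, h, Matrix.single_add]

theorem blockMatrix_zero : blockMatrix (0 : Matrix (Fin m) (Fin m) k) = 0 := by
  simpa using blockMatrix_add (0 : Matrix (Fin m) (Fin m) k) 0

theorem blockMatrix_neg (N : Matrix (Fin m) (Fin m) k) : blockMatrix (-N) = -blockMatrix N := by
  rw [eq_neg_iff_add_eq_zero, ← blockMatrix_add, neg_add_cancel, blockMatrix_zero]

theorem blockMatrix_sub (N N' : Matrix (Fin m) (Fin m) k) :
    blockMatrix (N - N') = blockMatrix N - blockMatrix N' := by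
  rw [sub_eq_add_neg, blockMatrix_add, blockMatrix_neg, ← sub_eq_add_neg]

theorem blockMatrix_zsmul (n : ℤ) (N : Matrix (Fin m) (Fin m) k) :
    blockMatrix (n • N) = n • blockMatrix N :=
  map_zsmul (⟨⟨blockMatrix, blockMatrix_zero⟩, blockMatrix_add⟩ :
    Matrix (Fin m) (Fin m) k →+ Matrix (Fin m) (Fin m) (Matrix (Fin m) (Fin m) k)) n N

theorem blockMatrix_one : blockMatrix (1 : Matrix (Fin m) (Fin m) k) = 1 := by
  ext1 i j
  by_cases h : i = j
  · subst h; simp [blockMatrix]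
  · simp [blockMatrix, h]

/-- Elementary matrices multiply as E i l * E l j = E i j. Triangularity excludes the products E i l
* E l i, which would spoil the scalar diagonal blocks. -/
theorem blockMatrix_mul {N N' : Matrix (Fin m) (Fin m) k} (h : ∀ i j, j < i → N i j = 0)
    (h' : ∀ i j, j < i → N' i j = 0) :
    blockMatrix (N * N') = blockMatrix N * blockMatrix N' := by
  ext1 i j
  rw [Matrix.mul_apply]
  by_cases hij : i = j
  · subst hij
    rw [Finset.sum_eq_single i]
    · have : (N * N') i i = N i i * N' i i := by
        rw [Matrix.mul_apply, Finset.sum_eq_single i]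
        · intro l _ hl
          rcases lt_or_gt_of_ne hl with hl | hl
          · rw [h i l hl, zero_mul]
          · rw [h' l i hl, mul_zero]
        · simp
      simp [blockMatrix, this, smul_smul, mul_comm]
    · intro l _ hl
      rcases lt_or_gt_of_ne hl with hl' | hl'
      · simp [blockMatrix, h i l hl', hl.symm]
      · simp [blockMatrix, h' l i hl', hl]
    · simp
  · have : blockMatrix (N * N') i j = ∑ l, Matrix.single i j (N i l * N' l j) := by
      simp only [blockMatrix, Matrix.of_apply, hij, if_false, Matrix.mul_apply]
      exact map_sum (Matrix.singleAddMonoidHom i j) _ _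
    rw [this]
    refine Finset.sum_congr rfl fun l _ => ?_
    by_cases h1 : i = l
    · subst h1
      simp [blockMatrix, hij]
    · by_cases h2 : l = j
      · subst h2
        simp [blockMatrix, hij, mul_comm]
      · simp [blockMatrix, h1, h2]

end Block

variable {ρ : ℕ} {R : Type} {𝓐 : SemiFreeDGA ρ R Unit} {k : Type*} [CommRing k] {m : ℕ}

/-- The superdiagonal matrix with entries `c i g`. -/
def superdiag (c : Fin m → HomGen R → k) (g : HomGen R) : Matrix (Fin m) (Fin m) k :=
  .of fun i j => if (i : ℕ) + 1 = j then c i g else 0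

/-- The matrix assigned to a generator: it is a multiple of an elementary matrix if the generator is
in a position `(i, i + 1)`, and zero otherwise. -/
def genMatrix (c : Fin m → HomGen R → k) : MGen R m → Matrix (Fin m) (Fin m) k
  | .a l i j => Matrix.single i j (superdiag c (.inl l) i j)
  | .x i j _ => Matrix.single i j (superdiag c (.inr .x) i j)
  | .y i j _ => Matrix.single i j (superdiag c (.inr .y) i j)

/-- The representation of the free algebra by the matrices of the generators. -/
def rep (c : Fin m → HomGen R → k) :
    MonoidAlgebra k (FreeMonoid (MGen R m)) →ₐ[k] Matrix (Fin m) (Fin m) k :=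
  MonoidAlgebra.lift k _ _ (FreeMonoid.lift (genMatrix c))

/-- The representation of the `m`-copy algebra obtained by twisting with augmentations. -/
def twistRep (ε : Fin m → Augmentation 𝓐 k) (c : Fin m → HomGen R → k) :
    MAlg R m →+* Matrix (Fin m) (Fin m) k :=
  (rep c).toRingHom.comp (twist ε)

/-- The values of the augmentations on `t`. -/
def tVal (ε : Fin m → Augmentation 𝓐 k) (i : Fin m) : kˣ :=
  Units.map (ε i).toRingHom.toMonoidHom (tUnit ())

variable (ε : Fin m → Augmentation 𝓐 k) (c : Fin m → HomGen R → k)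

theorem superdiag_eq_zero {g : HomGen R} {i j : Fin m} (h : j ≤ i) : superdiag c g i j = 0 := by
  have : (j : ℕ) ≤ i := h
  simp [superdiag]; omega

theorem twistRep_a (l : R) (i j : Fin m) : twistRep ε c (gen (.a l i j)) =
    blockMatrix (superdiag c (.inl l) + Matrix.diagonal fun i => (ε i).toRingHom (gen l)) i j := by
  have h1 : twistRep ε c (gen (.a l i j)) = genMatrix c (.a l i j) +
      rep c (if i = j then algebraMap k _ ((ε i).toRingHom (gen l)) else 0) := by
    simp [twistRep, twist, lift_gen, rep]
  rw [h1]
  by_cases h : i = j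
  · subst h
    simp [genMatrix, blockMatrix, superdiag_eq_zero, Algebra.algebraMap_eq_smul_one]
  · simp [genMatrix, blockMatrix, h]

theorem twistRep_x (i j : Fin m) (h : i < j) :
    twistRep ε c (gen (.x i j h)) = Matrix.single i j (superdiag c (.inr .x) i j) := by
  simp [twistRep, twist, lift_gen, rep, genMatrix]

theorem twistRep_y (i j : Fin m) (h : i < j) :
    twistRep ε c (gen (.y i j h)) = Matrix.single i j (superdiag c (.inr .y) i j) := by
  simp [twistRep, twist, lift_gen, rep, genMatrix]

theorem map_twistRep_tUnit (i : Fin m) : Units.map (twistRep ε c).toMonoidHom (tUnit i) =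
    Units.map (algebraMap k (Matrix (Fin m) (Fin m) k)).toMonoidHom (tVal ε i) := by
  ext1
  simp only [twistRep, twist, Units.coe_map]
  change rep c (SFAlg.lift _ _ _) = _
  rw [lift_tUnit]
  exact (rep c).commutes _

theorem mapMatrix_matA (l : R) : (twistRep ε c).mapMatrix (matA l) =
    blockMatrix (superdiag c (.inl l) + Matrix.diagonal fun i => (ε i).toRingHom (gen l)) := by
  ext1 i j
  exact twistRep_a ε c l i j

theorem mapMatrix_matN : (twistRep ε c).mapMatrix (matN : Matrix _ _ (MAlg R m)) =
    blockMatrix (superdiag c (.inr .x)) := by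
  ext1 i j
  rw [RingHom.mapMatrix_apply, Matrix.map_apply, matN]
  by_cases h : i < j
  · simp [h, twistRep_x, blockMatrix, h.ne]
  · have := superdiag_eq_zero c (g := .inr .x) (not_lt.1 h)
    rw [dif_neg h, map_zero]
    by_cases h' : i = j
    · subst h'; simp [blockMatrix, this]
    · simp [blockMatrix, this, h']

theorem mapMatrix_matY : (twistRep ε c).mapMatrix (matY : Matrix _ _ (MAlg R m)) =
    blockMatrix (superdiag c (.inr .y)) := by
  ext1 i j
  rw [RingHom.mapMatrix_apply, Matrix.map_apply, matY]
  by_cases h : i < j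
  · simp [h, twistRep_y, blockMatrix, h.ne]
  · have := superdiag_eq_zero c (g := .inr .y) (not_lt.1 h)
    rw [dif_neg h, map_zero]
    by_cases h' : i = j
    · subst h'; simp [blockMatrix, this]
    · simp [blockMatrix, this, h']

theorem mapMatrix_matX : (twistRep ε c).mapMatrix (matX : (Matrix _ _ (MAlg R m))ˣ).val =
    blockMatrix (1 + superdiag c (.inr .x)) := by
  have : (matX : (Matrix _ _ (MAlg R m))ˣ).val = 1 + matN := rfl
  rw [this, map_add, map_one, mapMatrix_matN, blockMatrix_add, blockMatrix_one]

theorem mapMatrix_matΔ : (twistRep ε c).mapMatrix (matΔ : (Matrix _ _ (MAlg R m))ˣ).val =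
    blockMatrix (Matrix.diagonal fun i => (tVal ε i).val) := by
  have : (matΔ : (Matrix _ _ (MAlg R m))ˣ).val = Matrix.diagonal fun i => (tUnit i).val := rfl
  rw [this]
  ext1 i j
  rw [RingHom.mapMatrix_apply, Matrix.map_apply]
  by_cases h : i = j
  · subst h
    have := congrArg Units.val (map_twistRep_tUnit ε c i)
    simpa [blockMatrix, Algebra.algebraMap_eq_smul_one] using this
  · simp [h, blockMatrix]

theorem mapMatrix_matΔ_inv : (twistRep ε c).mapMatrix (matΔ⁻¹ : (Matrix _ _ (MAlg R m))ˣ).val =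
    blockMatrix (Matrix.diagonal fun i => ((tVal ε i)⁻¹ : kˣ).val) := by
  have : (matΔ⁻¹ : (Matrix _ _ (MAlg R m))ˣ).val =
    Matrix.diagonal fun i => ((tUnit i)⁻¹ : (MAlg R m)ˣ).val := rfl
  rw [this]
  ext1 i j
  rw [RingHom.mapMatrix_apply, Matrix.map_apply]
  by_cases h : i = j
  · subst h
    have := congrArg (fun u => (u⁻¹).val) (map_twistRep_tUnit ε c i)
    simpa [blockMatrix, Algebra.algebraMap_eq_smul_one, ← map_inv] using this
  · simp [h, blockMatrix]

variable {ε c}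

/-- The ring homomorphism `Φ` in the representation: `Θ` is the upper triangular form of `Φ`. -/
theorem mapMatrix_Φ {Θ : SFAlg R Unit →+* Matrix (Fin m) (Fin m) k}
    (hΘ : ∀ x i j, j < i → Θ x i j = 0)
    (hg : ∀ a, Θ (gen a) =
      superdiag c (.inl a) + Matrix.diagonal fun i => (ε i).toRingHom (gen a))
    (ht : Θ (tUnit ()).val =
      (Matrix.diagonal fun i => (tVal ε i).val) * (1 + superdiag c (.inr .x)))
    (x : SFAlg R Unit) : (twistRep ε c).mapMatrix (Φ x) = blockMatrix (Θ x) := by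
  -- Triangularity of Θ makes the right side multiplicative, so a comparison on generators is
  -- enough.
  let Ψ : SFAlg R Unit →+* Matrix (Fin m) (Fin m) (Matrix (Fin m) (Fin m) k) :=
    { toFun := fun x => blockMatrix (Θ x)
      map_one' := by rw [map_one, blockMatrix_one]
      map_zero' := by rw [map_zero, blockMatrix_zero]
      map_add' := fun x y => by rw [map_add, blockMatrix_add]
      map_mul' := fun x y => by rw [map_mul, blockMatrix_mul (hΘ x) (hΘ y)] }
  refine RingHom.congr_fun (f := (twistRep ε c).mapMatrix.comp Φ) (g := Ψ) (ringHom_ext ?_ ?_) x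
  · intro a
    change (twistRep ε c).mapMatrix (Φ (gen a)) = blockMatrix (Θ (gen a))
    rw [hg, Φ, lift_gen, mapMatrix_matA]
  · intro t
    change (twistRep ε c).mapMatrix (Φ (tUnit ()).val) = blockMatrix (Θ (tUnit ()).val)
    rw [ht, Φ, lift_tUnit, Units.val_mul, map_mul, mapMatrix_matΔ, mapMatrix_matX, blockMatrix_mul]
    · intro i j hij; exact Matrix.diagonal_apply_ne _ hij.ne'
    · intro i j hij; simp [superdiag_eq_zero c hij.le, hij.ne']

/-- The matrix formula for ∂A passes through `blockMatrix`, and the (i, j) entry of block (i, j)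
recovers the scalar entry. The differential of the m-copy is thus computed in scalar matrices. -/
theorem rep_twistedD_a {Θ : SFAlg R Unit →+* Matrix (Fin m) (Fin m) k}
    (hΘ : ∀ x i j, j < i → Θ x i j = 0)
    (hg : ∀ a, Θ (gen a) =
      superdiag c (.inl a) + Matrix.diagonal fun i => (ε i).toRingHom (gen a))
    (ht : Θ (tUnit ()).val =
      (Matrix.diagonal fun i => (tVal ε i).val) * (1 + superdiag c (.inr .x)))
    (a : R) (i j : Fin m) : rep c (twistedD ε (.a a i j)) i j =
      (Θ (𝓐.d (gen a)) + superdiag c (.inr .y) * Θ (gen a) -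
        degSign (𝓐.deg a) • (Θ (gen a) * superdiag c (.inr .y)) : Matrix (Fin m) (Fin m) k) i j := by
  have hy : ∀ i j : Fin m, j < i → superdiag c (.inr .y) i j = 0 :=
    fun i j h => superdiag_eq_zero c h.le
  rw [← blockMatrix_apply_self (_ - _) i j, blockMatrix_sub, blockMatrix_add, blockMatrix_zsmul,
    blockMatrix_mul hy (hΘ _), blockMatrix_mul (hΘ _) hy, ← mapMatrix_Φ hΘ hg ht, hg,
    ← mapMatrix_matA, ← mapMatrix_matY ε c, ← map_mul, ← map_mul, ← map_zsmul, ← map_add, ← map_sub]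
  rfl

theorem rep_twistedD_x (i j : Fin m) (h : i < j) : rep c (twistedD ε (.x i j h)) i j =
      ((Matrix.diagonal fun i => ((tVal ε i)⁻¹ : kˣ).val) * superdiag c (.inr .y) *
        (Matrix.diagonal fun i => (tVal ε i).val) * (1 + superdiag c (.inr .x)) -
        (1 + superdiag c (.inr .x)) * superdiag c (.inr .y) : Matrix (Fin m) (Fin m) k) i j := by
  have hs : ∀ g, ∀ i j : Fin m, j < i → superdiag c g i j = 0 :=
    fun g i j h => superdiag_eq_zero c h.le
  have hd : ∀ f : Fin m → k, ∀ i j : Fin m, j < i → Matrix.diagonal f i j = 0 :=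
    fun f i j h => Matrix.diagonal_apply_ne _ h.ne'
  have h1 : ∀ i j : Fin m, j < i → (1 + superdiag c (.inr .x)) i j = 0 := by
    intro i j hij; simp [superdiag_eq_zero c hij.le, hij.ne']
  have hm : ∀ N N' : Matrix (Fin m) (Fin m) k, (∀ i j, j < i → N i j = 0) →
      (∀ i j, j < i → N' i j = 0) → ∀ i j, j < i → (N * N') i j = 0 := by
    intro N N' hN hN' i j hij
    rw [Matrix.mul_apply]
    refine Finset.sum_eq_zero fun l _ => ?_
    rcases lt_or_ge l i with hl | hl
    · rw [hN i l hl, zero_mul]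
    · rw [hN' l j (hij.trans_le hl), mul_zero]
  rw [← blockMatrix_apply_self (_ - _) i j, blockMatrix_sub, blockMatrix_mul h1 (hs _),
    blockMatrix_mul (hm _ _ (hm _ _ (hd _) (hs _)) (hd _)) h1,
    blockMatrix_mul (hm _ _ (hd _) (hs _)) (hd _), blockMatrix_mul (hd _) (hs _),
    ← mapMatrix_matX ε c, ← mapMatrix_matY ε c, ← mapMatrix_matΔ ε c, ← mapMatrix_matΔ_inv ε c,
    ← map_mul, ← map_mul, ← map_mul, ← map_mul, ← map_sub]
  rfl

theorem rep_twistedD_y (i j : Fin m) (h : i < j) : rep c (twistedD ε (.y i j h)) i j =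
      (superdiag c (.inr .y) * superdiag c (.inr .y) : Matrix (Fin m) (Fin m) k) i j := by
  have hs : ∀ i j : Fin m, j < i → superdiag c (.inr .y) i j = 0 :=
    fun i j h => superdiag_eq_zero c h.le
  rw [← blockMatrix_apply_self (_ * _) i j, blockMatrix_mul hs hs, ← mapMatrix_matY ε c, ← map_mul]
  rfl

/-! ### The representation computes the coefficients -/

theorem genMatrix_apply_ne (c : Fin m → HomGen R → k) (s : MGen R m) {i j : Fin m}
    (h : (i : ℕ) + 1 ≠ j) : genMatrix c s i j = 0 := by
  have key : ∀ (g : HomGen R) (p q : Fin m), Matrix.single p q (superdiag c g p q) i j = 0 := by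
    intro g p q
    by_cases hpq : p = i ∧ q = j
    · obtain ⟨rfl, rfl⟩ := hpq
      simp [superdiag, h]
    · rw [Matrix.single_apply_of_ne]
      exact hpq
  cases s <;> exact key _ _ _

open Classical in
theorem genMatrix_apply [Fintype R] (c : Fin m → HomGen R → k) (s : MGen R m) {i j : Fin m}
    (h : (i : ℕ) + 1 = j) (hij : i < j) :
    genMatrix c s i j = ∑ g : HomGen R, if g.at i j hij = s then c i g else 0 := by
  have hu : (Finset.univ : Finset ShortGen) = {.x, .y} := rfl
  rw [Fintype.sum_sum_type, hu, Finset.sum_pair (by simp)]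
  cases s with
  | a l p q =>
    simp only [HomGen.at, genMatrix, MGen.a.injEq, reduceCtorEq, if_false, add_zero]
    by_cases hpq : p = i ∧ q = j
    · obtain ⟨rfl, rfl⟩ := hpq
      simp [superdiag, h]
    · rw [Matrix.single_apply_of_ne _ _ _ _ _ hpq]
      refine (Finset.sum_eq_zero fun x _ => if_neg ?_).symm
      rintro ⟨-, rfl, rfl⟩
      exact hpq ⟨rfl, rfl⟩
  | x p q hp =>
    simp only [HomGen.at, genMatrix, MGen.x.injEq, reduceCtorEq, if_false, add_zero,
      Finset.sum_const_zero, zero_add]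
    by_cases hpq : p = i ∧ q = j
    · obtain ⟨rfl, rfl⟩ := hpq
      simp [superdiag, h]
    · rw [Matrix.single_apply_of_ne _ _ _ _ _ hpq, if_neg]
      rintro ⟨rfl, rfl⟩
      exact hpq ⟨rfl, rfl⟩
  | y p q hp =>
    simp only [HomGen.at, genMatrix, MGen.y.injEq, reduceCtorEq, if_false,
      Finset.sum_const_zero, zero_add]
    by_cases hpq : p = i ∧ q = j
    · obtain ⟨rfl, rfl⟩ := hpq
      simp [superdiag, h]
    · rw [Matrix.single_apply_of_ne _ _ _ _ _ hpq, if_neg]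
      rintro ⟨rfl, rfl⟩
      exact hpq ⟨rfl, rfl⟩

/-- The composite of the representation of a word with an entry map. -/
theorem rep_single (c : Fin m → HomGen R → k) (w : FreeMonoid (MGen R m)) (r : k) :
    rep c (MonoidAlgebra.single w r) = r • (w.toList.map (genMatrix c)).prod := by
  simp [rep, FreeMonoid.lift_apply]

/-- Each letter of a word raises the index by exactly one, so the corner entry sees only words of
one letter, in position (0, 1). -/
theorem rep_two_apply [Fintype R] (c : Fin 2 → HomGen R → k)
    (z : MonoidAlgebra k (FreeMonoid (MGen R 2))) :
    rep c z 0 1 = ∑ g : HomGen R, c 0 g * z.coeff (.of (g.at 0 1 (by decide))) := by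
  classical
  induction z using MonoidAlgebra.induction_linear with
  | zero => simp
  | add f g hf hg => simp [hf, hg, mul_add, Finset.sum_add_distrib]
  | single w r =>
    rw [rep_single]
    simp only [MonoidAlgebra.coeff_single, Finsupp.single_apply, Matrix.smul_apply, smul_eq_mul]
    have hlow : ∀ s (i j : Fin 2), (i : ℕ) + 1 ≠ j → genMatrix c s i j = 0 :=
      fun s i j h => genMatrix_apply_ne c s h
    match hw : w.toList with
    | [] =>
      have : w = 1 := by rw [← FreeMonoid.ofList_toList w, hw]; rfl
      subst this
      simp [(FreeMonoid.of_ne_one _).symm]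
    | [s] =>
      have : w = .of s := by rw [← FreeMonoid.ofList_toList w, hw]; rfl
      subst this
      simp only [List.map_cons, List.map_nil, List.prod_cons, List.prod_nil, mul_one]
      rw [genMatrix_apply c s rfl (by decide), Finset.mul_sum]
      refine Finset.sum_congr rfl fun g _ => ?_
      simp [FreeMonoid.of_injective.eq_iff, eq_comm, mul_comm]
    | s₁ :: s₂ :: l =>
      have h1 : ∀ g : HomGen R, w ≠ .of (g.at 0 1 (by decide)) := by
        rintro g rfl
        simp at hw
      simp [h1, Matrix.mul_apply, Fin.sum_univ_two, hlow]

/-- Here the corner is two steps from the diagonal: only two-letter words through positions (0, 1)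
and (1, 2) contribute. -/
theorem rep_three_apply [Fintype R] (c : Fin 3 → HomGen R → k)
    (z : MonoidAlgebra k (FreeMonoid (MGen R 3))) :
    rep c z 0 2 = ∑ g : HomGen R, ∑ g' : HomGen R, c 0 g * c 1 g' *
      z.coeff (.of (g.at 0 1 (by decide)) * .of (g'.at 1 2 (by decide))) := by
  classical
  induction z using MonoidAlgebra.induction_linear with
  | zero => simp
  | add f g hf hg => simp [hf, hg, mul_add, Finset.sum_add_distrib]
  | single w r =>
    rw [rep_single]
    simp only [MonoidAlgebra.coeff_single, Finsupp.single_apply, Matrix.smul_apply, smul_eq_mul]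
    have hlow : ∀ s (i j : Fin 3), (i : ℕ) + 1 ≠ j → genMatrix c s i j = 0 :=
      fun s i j h => genMatrix_apply_ne c s h
    match hw : w.toList with
    | [] =>
      have h1 : ∀ g g' : HomGen R,
          w ≠ .of (g.at 0 1 (by decide)) * .of (g'.at 1 2 (by decide)) := by
        rintro g g' rfl
        simp at hw
      simp [h1]
    | [s] =>
      have h1 : ∀ g g' : HomGen R,
          w ≠ .of (g.at 0 1 (by decide)) * .of (g'.at 1 2 (by decide)) := by
        rintro g g' rfl
        simp at hw
      simp [h1, hlow]
    | [s₁, s₂] =>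
      have : w = .of s₁ * .of s₂ := by rw [← FreeMonoid.ofList_toList w, hw]; rfl
      subst this
      simp only [List.map_cons, List.map_nil, List.prod_cons, List.prod_nil, mul_one,
        Matrix.mul_apply, Fin.sum_univ_three, hlow s₁ 0 0 (by decide), hlow s₁ 0 2 (by decide),
        zero_mul, zero_add, add_zero]
      rw [genMatrix_apply c s₁ rfl (by decide), genMatrix_apply c s₂ rfl (by decide),
        Finset.sum_mul_sum, Finset.mul_sum]
      refine Finset.sum_congr rfl fun g _ => ?_
      rw [Finset.mul_sum]
      refine Finset.sum_congr rfl fun g' _ => ?_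
      have : (FreeMonoid.of s₁ * FreeMonoid.of s₂ =
          .of (g.at 0 1 (by decide)) * .of (g'.at 1 2 (by decide))) ↔
          g.at (m := 3) 0 1 (by decide) = s₁ ∧ g'.at (m := 3) 1 2 (by decide) = s₂ := by
        rw [← FreeMonoid.toList.injective.eq_iff]
        simp [eq_comm]
      rw [if_congr this rfl rfl, ite_and]
      split_ifs
      · ring
      all_goals simp
    | s₁ :: s₂ :: s₃ :: l =>
      have h1 : ∀ g g' : HomGen R,
          w ≠ .of (g.at 0 1 (by decide)) * .of (g'.at 1 2 (by decide)) := by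
        rintro g g' rfl
        simp at hw
      simp [h1, Matrix.mul_apply, Fin.sum_univ_three, hlow]

end AugPlus

namespace AugPlus

variable {ρ : ℕ} {R : Type} {𝓐 : SemiFreeDGA ρ R Unit} {k : Type*} [CommRing k]

/-! ### The operations `m₁` and `m₂` -/

section Comp

variable [Fintype R] (ε₁ ε₂ ε₃ : Augmentation 𝓐 k)

/-- The last row of a superdiagonal matrix is empty, so the last entry of `![v, 0]` is a dummy. -/
theorem m₁_eq_rep (v : AugHom R k) (g : HomGen R) :
    m₁ ε₁ ε₂ v g = rep ![v, 0] (twistedD ![ε₁, ε₂] (g.at 0 1 (by decide))) 0 1 := by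
  rw [rep_two_apply, m₁, comp]
  refine Fintype.sum_equiv (Equiv.funUnique (Fin 1) (HomGen R)) _ _ fun α => ?_
  have : 𝓐.sigma α = 0 := by simp [SemiFreeDGA.sigma]
  rw [this, pow_zero, one_mul, Fin.prod_univ_one]
  rfl

/-- For p = 2 the exponent is 1 + |v||w| + |v|. The 1 gives the overall minus; the rest must be
absorbed into v', which is possible as soon as one argument has degree 0. -/
theorem m₂_eq_rep {v v' w : AugHom R k}
    (h : ∀ g g', (-1) ^ (𝓐.parity g * 𝓐.parity g' + 𝓐.parity g) * (v g * w g') = v' g * w g')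
    (g : HomGen R) : m₂ ε₁ ε₂ ε₃ w v g =
      -rep ![v', w, 0] (twistedD ![ε₁, ε₂, ε₃] (g.at 0 2 (by decide))) 0 2 := by
  rw [rep_three_apply, ← Fintype.sum_prod_type', ← Finset.sum_neg_distrib, m₂, comp]
  refine Fintype.sum_equiv (finTwoArrowEquiv (HomGen R)) _ _ fun α => ?_
  have : 𝓐.sigma α = 1 + (𝓐.parity (α 0) * 𝓐.parity (α 1) + 𝓐.parity (α 0)) := by
    simp [SemiFreeDGA.sigma, Fin.sum_univ_two, add_assoc]
  rw [this, pow_add, pow_one, neg_one_mul, neg_mul, neg_mul, Fin.prod_univ_two]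
  congr 1
  have h' := h (α 0) (α 1)
  change _ * (v (α 0) * w (α 1)) * _ = v' (α 0) * w (α 1) * _
  rw [h']
  rfl

end Comp

theorem parity_eq_zero {g : HomGen R} (h : 𝓐.homDeg g = 0) : 𝓐.parity g = 0 := by
  simp [SemiFreeDGA.parity, h]

/-- The shift |a⁺| = |a| + 1 reverses parity. -/
theorem neg_one_pow_parity_inl (a : R) :
    (-1 : ℤ) ^ 𝓐.parity (.inl a) = -degSign (𝓐.deg a) := by
  have h : Even (𝓐.deg a + 1) ↔ ¬ Even (𝓐.deg a) := by
    let f := ZMod.castHom (Dvd.intro ρ rfl : 2 ∣ 2 * ρ) (ZMod 2)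
    have hf : ∀ x : ZMod (2 * ρ), Even x ↔ f x = 0 := by
      intro x
      constructor
      · rintro ⟨j, rfl⟩
        rw [map_add, CharTwo.add_self_eq_zero]
      · obtain ⟨n, rfl⟩ := ZMod.intCast_surjective x
        intro h
        rw [map_intCast, ZMod.intCast_eq_zero_iff_even] at h
        exact h.map (Int.castRingHom _)
    rw [hf, hf, map_add, map_one]
    generalize f (𝓐.deg a) = z
    revert z; decide
  by_cases he : Even (𝓐.deg a) <;> simp [SemiFreeDGA.parity, SemiFreeDGA.homDeg, degSign, h, he]

theorem parity_x : 𝓐.parity (.inr .x) = 1 := by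
  have : ¬ Even (1 : ZMod (2 * ρ)) := fun h => ZMod.not_even_neg_one ρ h.neg
  simp [SemiFreeDGA.parity, SemiFreeDGA.homDeg, this]

theorem parity_y : 𝓐.parity (.inr .y) = 0 := parity_eq_zero rfl

section Formulas

variable {ε₁ ε₂ ε₃ : Augmentation 𝓐 k} {K K₁ K₂ H : SFAlg R Unit →+ k} {v w : AugHom R k}

/-- `K` has the values on the generators that are prescribed by a morphism from `ε₁`. -/
structure Extends (ε₁ : Augmentation 𝓐 k) (v : AugHom R k) (K : SFAlg R Unit →+ k) : Prop where
  gen : ∀ a, K (gen a) = v (.inl a)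
  -- Φ(t) = ΔX has the entry t¹x¹² above the diagonal.
  tUnit : K (tUnit ()).val = ε₁.toRingHom (tUnit ()).val * v (.inr .x)

theorem exists_extends (ε₁ ε₂ : Augmentation 𝓐 k) (v : AugHom R k) :
    ∃ K, IsDer ε₁.toRingHom ε₂.toRingHom K ∧ Extends ε₁ v K := by
  obtain ⟨K, hK, hg, ht⟩ := exists_isDer ε₁.toRingHom ε₂.toRingHom (fun a => v (.inl a))
    (fun _ => ε₁.toRingHom (SFAlg.tUnit ()).val * v (.inr .x))
  exact ⟨K, hK, hg, ht ()⟩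

theorem degSign_smul_map_gen (ε : Augmentation 𝓐 k) (a : R) :
    degSign (𝓐.deg a) • ε.toRingHom (gen a) = ε.toRingHom (gen a) := by
  have := ε.map_signHom (gen a)
  rwa [signHom_gen, map_zsmul] at this

theorem toMatrix_low (hK : IsDer ε₁.toRingHom ε₂.toRingHom K) (x : SFAlg R Unit) (i j : Fin 2)
    (h : j < i) : hK.toMatrix x i j = 0 := by
  fin_cases i <;> fin_cases j <;> simp_all [IsDer.toMatrix]

theorem toMatrix_gen (hK : IsDer ε₁.toRingHom ε₂.toRingHom K) (hv : Extends ε₁ v K) (a : R) :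
    hK.toMatrix (gen a) = superdiag ![v, 0] (.inl a) +
      Matrix.diagonal fun i => (![ε₁, ε₂] i).toRingHom (gen a) := by
  ext i j
  fin_cases i <;> fin_cases j <;> simp [IsDer.toMatrix, superdiag, hv.gen]

theorem toMatrix_tUnit (hK : IsDer ε₁.toRingHom ε₂.toRingHom K) (hv : Extends ε₁ v K) :
    hK.toMatrix (tUnit ()).val = (Matrix.diagonal fun i => (tVal ![ε₁, ε₂] i).val) *
      (1 + superdiag ![v, 0] (.inr .x)) := by
  ext i j
  fin_cases i <;> fin_cases j <;>
    simp [IsDer.toMatrix, superdiag, hv.tUnit, tVal]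

/-- Φ(∂a) contributes K(∂a), and the terms with Y contribute the difference of the augmentations;
the sign drops since ε₁ lives in degree 0. -/
theorem m₁_inl [Fintype R] (hK : IsDer ε₁.toRingHom ε₂.toRingHom K) (hv : Extends ε₁ v K)
    (a : R) : m₁ ε₁ ε₂ v (.inl a) =
      K (𝓐.d (gen a)) + v (.inr .y) * (ε₂.toRingHom (gen a) - ε₁.toRingHom (gen a)) := by
  rw [m₁_eq_rep]
  change rep _ (twistedD _ (.a a 0 1)) 0 1 = _
  rw [rep_twistedD_a (toMatrix_low hK) (toMatrix_gen hK hv) (toMatrix_tUnit hK hv)]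
  rw [Matrix.sub_apply, Matrix.add_apply, Matrix.smul_apply, Matrix.mul_apply, Matrix.mul_apply]
  simp only [Fin.sum_univ_two]
  simp [superdiag, IsDer.toMatrix]
  rw [← zsmul_eq_mul, ← smul_mul_assoc, degSign_smul_map_gen]
  ring

/-- This coefficient forces ε₁(t) = ε₂(t) when v is a cocycle with invertible y⁺-coefficient. `tVal
![ε₁] 0` is ε₁(t) as a unit. -/
theorem m₁_x [Fintype R] : m₁ ε₁ ε₂ v (.inr .x) =
    v (.inr .y) * ((tVal ![ε₁] 0)⁻¹.val * (tVal ![ε₂] 0).val - 1) := by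
  rw [m₁_eq_rep]
  change rep _ (twistedD _ (.x 0 1 _)) 0 1 = _
  rw [rep_twistedD_x, Matrix.sub_apply]
  simp [Matrix.mul_apply, Fin.sum_univ_two, superdiag, tVal]
  ring

/-- Y² starts two steps above the diagonal. Hence the y⁺-coefficient is an invariant of the
cohomology class. -/
theorem m₁_y [Fintype R] : m₁ ε₁ ε₂ v (.inr .y) = 0 := by
  rw [m₁_eq_rep]
  change rep _ (twistedD _ (.y 0 1 _)) 0 1 = _
  rw [rep_twistedD_y]
  simp [Matrix.mul_apply, superdiag]

/-- The upper triangular form of `Φ` for two composable derivations and a pairing. -/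
def toMatrixThree {S : Type*} [Ring S] {e₁ e₂ e₃ : SFAlg R Unit →+* S}
    {K₁ K₂ H : SFAlg R Unit →+ S} (h₁ : IsDer e₁ e₂ K₁) (h₂ : IsDer e₂ e₃ K₂)
    (h : IsPairing e₁ e₃ K₁ K₂ H) : SFAlg R Unit →+* Matrix (Fin 3) (Fin 3) S where
  toFun x := !![e₁ x, K₁ x, H x; 0, e₂ x, K₂ x; 0, 0, e₃ x]
  map_one' := by
    ext i j
    fin_cases i <;> fin_cases j <;> simp [h₁.map_one, h₂.map_one, h.map_one h₁.map_one]
  map_zero' := by ext i j; fin_cases i <;> fin_cases j <;> simp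
  map_add' x y := by ext i j; fin_cases i <;> fin_cases j <;> simp
  map_mul' x y := by
    ext i j
    fin_cases i <;> fin_cases j <;>
      simp [Matrix.mul_apply, Fin.sum_univ_three, h₁ x y, h₂ x y, h x y] <;> abel

/-- Generators in position (0, 2) are represented by zero, so the corner of the triangular form is
the cup product H that vanishes on all generators, t included. -/
theorem m₂_inl [Fintype R] {v' : AugHom R k} (h₁ : IsDer ε₁.toRingHom ε₂.toRingHom K₁)
    (h₂ : IsDer ε₂.toRingHom ε₃.toRingHom K₂) (hH : IsPairing ε₁.toRingHom ε₃.toRingHom K₁ K₂ H)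
    (hg : ∀ a, H (gen a) = 0) (ht : ∀ t, H (tUnit t).val = 0) (hv : Extends ε₁ v' K₁)
    (hw : Extends ε₂ w K₂)
    (h : ∀ g g', (-1) ^ (𝓐.parity g * 𝓐.parity g' + 𝓐.parity g) * (v g * w g') = v' g * w g')
    (a : R) : m₂ ε₁ ε₂ ε₃ w v (.inl a) =
      -(H (𝓐.d (gen a)) + v' (.inr .y) * w (.inl a) -
        degSign (𝓐.deg a) • (v' (.inl a) * w (.inr .y))) := by
  rw [m₂_eq_rep _ _ _ h]
  change -rep _ (twistedD _ (.a a 0 2)) 0 2 = _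
  rw [rep_twistedD_a (Θ := toMatrixThree h₁ h₂ hH)]
  · rw [Matrix.sub_apply, Matrix.add_apply, Matrix.smul_apply, Matrix.mul_apply, Matrix.mul_apply]
    simp only [Fin.sum_univ_three]
    simp [superdiag, toMatrixThree, hv.gen, hw.gen]
  · intro x i j hij
    fin_cases i <;> fin_cases j <;> simp_all [toMatrixThree]
  · intro a
    ext i j
    fin_cases i <;> fin_cases j <;> simp [toMatrixThree, superdiag, hv.gen, hw.gen, hg]
  · ext i j
    fin_cases i <;> fin_cases j <;>
      simp [toMatrixThree, superdiag, hv.tUnit, hw.tUnit, ht, tVal]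

theorem m₂_x [Fintype R] {v' : AugHom R k}
    (h : ∀ g g', (-1) ^ (𝓐.parity g * 𝓐.parity g' + 𝓐.parity g) * (v g * w g') = v' g * w g') :
    m₂ ε₁ ε₂ ε₃ w v (.inr .x) =
      -((tVal ![ε₁] 0)⁻¹.val * v' (.inr .y) * (tVal ![ε₂] 0).val * w (.inr .x) -
        v' (.inr .x) * w (.inr .y)) := by
  rw [m₂_eq_rep _ _ _ h]
  change -rep _ (twistedD _ (.x 0 2 _)) 0 2 = _
  rw [rep_twistedD_x, Matrix.sub_apply]
  simp [Matrix.mul_apply, Fin.sum_univ_three, superdiag, tVal]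

theorem m₂_y [Fintype R] {v' : AugHom R k}
    (h : ∀ g g', (-1) ^ (𝓐.parity g * 𝓐.parity g' + 𝓐.parity g) * (v g * w g') = v' g * w g') :
    m₂ ε₁ ε₂ ε₃ w v (.inr .y) = -(v' (.inr .y) * w (.inr .y)) := by
  rw [m₂_eq_rep _ _ _ h]
  change -rep _ (twistedD _ (.y 0 2 _)) 0 2 = _
  rw [rep_twistedD_y]
  simp [Matrix.mul_apply, Fin.sum_univ_three, superdiag]

theorem sign_of_isDegreeZero_left (hv : IsDegreeZero 𝓐 v) (w : AugHom R k) (g g' : HomGen R) :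
    (-1) ^ (𝓐.parity g * 𝓐.parity g' + 𝓐.parity g) * (v g * w g') = v g * w g' := by
  by_cases h : 𝓐.homDeg g = 0
  · simp [parity_eq_zero h]
  · simp [hv g h]

/-- If w has degree 0, only the sign (-1)^|v| survives, and it depends on the first argument alone.
-/
theorem sign_of_isDegreeZero_right (hw : IsDegreeZero 𝓐 w) (v : AugHom R k) (g g' : HomGen R) :
    (-1) ^ (𝓐.parity g * 𝓐.parity g' + 𝓐.parity g) * (v g * w g') =
      ((-1) ^ 𝓐.parity g * v g) * w g' := by
  by_cases h : 𝓐.homDeg g' = 0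
  · simp [parity_eq_zero h, mul_assoc]
  · simp [hw g' h]

end Formulas

/-! ### Homotopies and isomorphisms -/

/-- The morphism with coefficients `f` at the Reeb chords, `0` at `x^+` and `c` at `y^+`. -/
def homOf (f : R → k) (c : k) : AugHom R k :=
  Sum.elim f fun s => match s with
    | .x => 0
    | .y => c

section Main

variable {ε₁ ε₂ : Augmentation 𝓐 k} {K : SFAlg R Unit →+ k}

theorem isDegreeZero_homOf {f : R → k} (hf : ∀ a, 𝓐.deg a ≠ -1 → f a = 0) (c : k) :
    IsDegreeZero 𝓐 (homOf f c) := by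
  rintro (a | (_ | _)) h
  · exact hf a fun h' => h (by simp [SemiFreeDGA.homDeg, h'])
  · rfl
  · exact absurd rfl h

theorem isDegreeZero_unit : IsDegreeZero 𝓐 (homOf 0 (-1) : AugHom R k) :=
  isDegreeZero_homOf (fun _ _ => rfl) _

theorem extends_homOf {f : R → k} (c : k) (ε : Augmentation 𝓐 k) (hg : ∀ a, K (gen a) = f a)
    (ht : K (tUnit ()).val = 0) : Extends ε (homOf f c) K :=
  ⟨hg, by rw [ht]; simp [homOf]⟩

theorem isDer_zero (ε₁ ε₂ : Augmentation 𝓐 k) :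
    IsDer ε₁.toRingHom ε₂.toRingHom (0 : SFAlg R Unit →+ k) := fun x y => by simp

variable [Fintype R]

/-- `-y^+` is a strict unit on the one side. -/
theorem m₂_unit_right (ε ε' : Augmentation 𝓐 k) (v : AugHom R k) :
    m₂ ε ε ε' v (homOf 0 (-1)) = v := by
  obtain ⟨K, hK, hv⟩ := exists_extends ε ε' v
  have hs := sign_of_isDegreeZero_left (𝓐 := 𝓐) isDegreeZero_unit v
  ext g
  rcases g with a | (_ | _)
  · rw [m₂_inl (isDer_zero ε ε) hK (H := 0) (fun x y => by simp) (fun _ => rfl) (fun _ => rfl)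
      (extends_homOf (f := 0) _ _ (fun _ => rfl) rfl) hv hs]
    simp [homOf]
  · rw [m₂_x hs]; simp [homOf]
  · rw [m₂_y hs]; simp [homOf]

/-- `-y^+` is a strict unit on the other side. -/
theorem m₂_unit_left (ε' ε : Augmentation 𝓐 k) (v : AugHom R k) :
    m₂ ε' ε ε (homOf 0 (-1)) v = v := by
  have hs := sign_of_isDegreeZero_right (𝓐 := 𝓐) isDegreeZero_unit v
  obtain ⟨K, hK, hv⟩ := exists_extends ε' ε fun g => (-1) ^ 𝓐.parity g * v g
  ext g
  rcases g with a | (_ | _)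
  · rw [m₂_inl hK (isDer_zero ε ε) (H := 0) (fun x y => by simp) (fun _ => rfl) (fun _ => rfl)
      hv (extends_homOf (f := 0) _ _ (fun _ => rfl) rfl) hs]
    -- The convention multiplies v(a) by -(-1)^|a|, and the term AY brings in a second (-1)^|a|,
    -- which cancels the first.
    have h1 : (-1 : k) ^ 𝓐.parity (.inl a) = ((-degSign (𝓐.deg a) : ℤ) : k) := by
      rw [← neg_one_pow_parity_inl]; push_cast; rfl
    have h2 : degSign (𝓐.deg a) * degSign (𝓐.deg a) = 1 := by
      unfold degSign; split_ifs <;> rfl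
    have h3 : ((degSign (𝓐.deg a) : ℤ) : k) * ((degSign (𝓐.deg a) : ℤ) : k) = 1 := by
      exact_mod_cast congrArg (Int.cast : ℤ → k) h2
    rw [h1]
    simp [homOf]
    linear_combination v (.inl a) * h3
  · rw [m₂_x hs]; simp [homOf, parity_x]
  · rw [m₂_y hs]; simp [homOf, parity_y]

/-- With y⁺-coefficient -1 and chord coefficients -K(a), the formula for `m₁` at a is ε₁(a) - ε₂(a)
- K(∂a) up to sign. -/
theorem isCocycleZero_homOf (hK : IsHomotopy ε₁ ε₂ K) :
    IsCocycleZero ε₁ ε₂ (homOf (fun a => -K (gen a)) (-1)) := by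
  have hE : Extends ε₁ (homOf (fun a => -K (gen a)) (-1)) (-K) :=
    extends_homOf _ _ (fun _ => rfl) (by simp [hK.map_tUnit])
  refine ⟨isDegreeZero_homOf (fun a ha => ?_) _, ?_⟩
  · rw [hK.hasDegree _ _ ha (isHomogeneous_gen a), neg_zero]
  · ext g
    rcases g with a | (_ | _)
    · rw [m₁_inl hK.isDer.neg hE, AddMonoidHom.neg_apply, ← hK.sub_eq]
      simp [homOf]
    · have ht : tVal ![ε₁] 0 = tVal ![ε₂] 0 := by
        ext1
        have := hK.sub_eq (tUnit ()).val
        rw [𝓐.d_t, map_zero, sub_eq_zero] at this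
        exact this
      rw [m₁_x, ht]; simp
    · rw [m₁_y]; rfl

/-- It is the morphism of the zero homotopy, hence a cocycle; the unit laws hold on the nose. -/
theorem isIdentity_unit (ε : Augmentation 𝓐 k) : IsIdentity ε (homOf 0 (-1)) := by
  have h0 : IsHomotopy ε ε (0 : SFAlg R Unit →+ k) :=
    ⟨⟨isDer_zero ε ε, fun _ _ _ _ => rfl⟩, fun x => by simp⟩
  have hz : ∀ ε' : Augmentation 𝓐 k, m₁ ε ε' 0 = 0 := by
    intro ε'
    ext g
    rw [m₁_eq_rep, rep_two_apply]; simp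
  have hz' : ∀ ε' : Augmentation 𝓐 k, m₁ ε' ε 0 = 0 := by
    intro ε'
    ext g
    rw [m₁_eq_rep, rep_two_apply]; simp
  refine ⟨?_, fun ε' v _ => ⟨0, ?_⟩, fun ε' v _ => ⟨0, ?_⟩⟩
  · have := isCocycleZero_homOf h0
    have e : (fun a => -(0 : SFAlg R Unit →+ k) (gen a)) = 0 := by ext; simp
    rwa [e] at this
  · rw [m₂_unit_right, sub_self, hz]
  · rw [m₂_unit_left, sub_self, hz']

/-- The composition of the morphisms given by two homotopies. -/
theorem m₂_homOf {ε₃ : Augmentation 𝓐 k} {K₁ K₂ H : SFAlg R Unit →+ k}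
    (h₁ : IsDegreeOneDer ε₁ ε₂ K₁) (h₂ : IsDegreeOneDer ε₂ ε₃ K₂)
    (hH : IsPairing ε₁.toRingHom ε₃.toRingHom K₁ K₂ H) (hg : ∀ a, H (gen a) = 0)
    (ht : ∀ t, H (tUnit t).val = 0) :
    m₂ ε₁ ε₂ ε₃ (homOf (fun a => -K₂ (gen a)) (-1)) (homOf (fun a => -K₁ (gen a)) (-1)) =
      homOf (fun a => -(K₁ (gen a) + K₂ (gen a) + H (𝓐.d (gen a)))) (-1) := by
  have hd : IsDegreeZero 𝓐 (homOf (fun a => -K₁ (gen a)) (-1)) :=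
    isDegreeZero_homOf (fun a ha => by rw [h₁.hasDegree _ _ ha (isHomogeneous_gen a), neg_zero]) _
  have hs := sign_of_isDegreeZero_left hd (homOf (fun a => -K₂ (gen a)) (-1))
  have hH' : IsPairing ε₁.toRingHom ε₃.toRingHom (-K₁) (-K₂) H := fun x y => by
    rw [hH]; simp
  ext g
  rcases g with a | (_ | _)
  · rw [m₂_inl h₁.isDer.neg h₂.isDer.neg hH' hg ht
      (extends_homOf (f := fun a => -K₁ (gen a)) _ _ (fun _ => rfl)
        (by simp [h₁.map_tUnit]))
      (extends_homOf (f := fun a => -K₂ (gen a)) _ _ (fun _ => rfl)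
        (by simp [h₂.map_tUnit])) hs]
    -- K₁(a) can be nonzero only in degree -1, which is odd.
    have : degSign (𝓐.deg a) • K₁ (gen a) = -K₁ (gen a) := by
      rw [← h₁.map_signHom, signHom_gen, map_zsmul]
    rw [zsmul_eq_mul] at this
    simp [homOf]
    linear_combination this
  · rw [m₂_x hs]; simp [homOf]
  · rw [m₂_y hs]; simp [homOf]

theorem isomorphic_of_isHomotopy {h : R → ℝ} (hA : 𝓐.IsFiltered h) (hK : IsHomotopy ε₁ ε₂ K) :
    Isomorphic ε₁ ε₂ := by
  obtain ⟨L, H, H', Q, hL, ⟨hH, hHg, hHt, hKL⟩, ⟨hH', hH'g, hH't⟩, hQ, hQt, hLK⟩ :=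
    hK.exists_twoSided_inverse hA
  -- One composite equals the unit. The other differs from it by -Q(∂a) at each chord a, which is
  -- `m₁` of the morphism with chord coefficients -Q(a) and no y⁺-term.
  refine ⟨_, _, _, _, isCocycleZero_homOf hK, isCocycleZero_homOf hL, isIdentity_unit ε₁,
    isIdentity_unit ε₂, ⟨0, ?_⟩, ⟨homOf (fun a => -Q (gen a)) 0, ?_⟩⟩
  · rw [m₂_homOf hK.toIsDegreeOneDer hL.toIsDegreeOneDer hH hHg hHt]
    have : m₁ ε₁ ε₁ 0 = 0 := by
      ext g
      rw [m₁_eq_rep, rep_two_apply]; simp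
    rw [this, sub_eq_zero]
    congr 1
    ext a
    simp [hKL]
  · rw [m₂_homOf hL.toIsDegreeOneDer hK.toIsDegreeOneDer hH' hH'g hH't]
    have hE : Extends ε₂ (homOf (fun a => -Q (gen a)) 0) (-Q) :=
      extends_homOf _ _ (fun _ => rfl) (by simp [hQt])
    ext g
    rcases g with a | (_ | _)
    · rw [m₁_inl hQ.neg hE]
      simp [homOf, hLK]
    · rw [m₁_x]; simp [homOf]
    · rw [m₁_y]; simp [homOf]

theorem Cohomologous.apply_y {v w : AugHom R k} (h : Cohomologous ε₁ ε₂ v w) :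
    v (.inr .y) = w (.inr .y) := by
  obtain ⟨c, hc⟩ := h
  have := congrFun hc (.inr .y)
  rw [m₁_y, Pi.sub_apply, sub_eq_zero] at this
  exact this

/-- Composed with the strict unit -y⁺, the cocycle u is both u itself and cohomologous to -y⁺. -/
theorem IsIdentity.apply_y {u : AugHom R k} (h : IsIdentity ε₁ u) : u (.inr .y) = -1 := by
  have := (h.2.1 ε₁ (homOf 0 (-1)) (isIdentity_unit ε₁).1.2).apply_y
  rw [m₂_unit_left] at this
  exact this

theorem Isomorphic.exists_isHomotopy (h : Isomorphic ε₁ ε₂) : ∃ K, IsHomotopy ε₁ ε₂ K := by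
  obtain ⟨v, w, u₁, u₂, ⟨hv, hv'⟩, -, hu₁, -, h₁, -⟩ := h
  have hy := h₁.apply_y
  rw [m₂_y (sign_of_isDegreeZero_left hv w), hu₁.apply_y, neg_inj] at hy
  have hvx : v (.inr .x) = 0 := hv _ (ZMod.one_ne_zero_two_mul ρ)
  obtain ⟨K, hK, hKg⟩ := IsDegreeOneDer.exists_of_gen ε₁ ε₂ (fun a => v (.inl a))
    (fun a ha => hv (.inl a) fun h0 => ha (eq_neg_of_add_eq_zero_left h0))
  have hE : Extends ε₁ v K := ⟨hKg, by rw [hK.map_tUnit, hvx, mul_zero]⟩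
  -- By `hy`, c inverts the y⁺-coefficient of v; multiplying the cocycle equation by c normalizes it
  -- to the homotopy equation.
  let c := w (.inr .y)
  have hcK : IsDegreeOneDer ε₁ ε₂ ((AddMonoidHom.mulLeft c).comp K) := by
    refine ⟨fun x y => ?_, fun i x hi hx => ?_⟩
    · change c * K (x * y) = c * K x * _ + _ * (c * K y)
      rw [hK.isDer]; ring
    · change c * K x = 0
      rw [hK.hasDegree i x hi hx, mul_zero]
  refine ⟨_, hcK.isHomotopy (fun a => ?_) (fun t => ?_)⟩
  · change _ = c * K _
    have h0 := congrFun hv' (.inl a)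
    rw [m₁_inl hK.isDer hE, Pi.zero_apply] at h0
    linear_combination (-c) * h0 - (ε₁.toRingHom (gen a) - ε₂.toRingHom (gen a)) * hy
  · have h0 := congrFun hv' (.inr .x)
    rw [m₁_x, Pi.zero_apply] at h0
    have h1 : (tVal ![ε₁] 0)⁻¹.val * (tVal ![ε₂] 0).val = 1 := by
      linear_combination c * h0 - ((tVal ![ε₁] 0)⁻¹.val * (tVal ![ε₂] 0).val - 1) * hy
    rw [Units.inv_mul_eq_one] at h1
    exact h1

/-- Over a DGA with a height filtration, homotopic augmentations are the isomorphic ones. -/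
theorem dgaHomotopic_iff_isomorphic {h : R → ℝ} (hA : 𝓐.IsFiltered h) :
    DGAHomotopic ε₁ ε₂ ↔ Isomorphic ε₁ ε₂ := by
  rw [dgaHomotopic_iff]
  exact ⟨fun ⟨_, hK⟩ => isomorphic_of_isHomotopy hA hK, Isomorphic.exists_isHomotopy⟩

end Main

end AugPlus

/-! ### Stokes' theorem on the disk -/

section Stokes

open MeasureTheory Set Filter Topology

/-- Stokes' theorem on a rectangle for the pullback of the form `y dx`. -/
theorem integral_rectangle_pullback (X Y : ℝ × ℝ → ℝ) (a₁ a₂ b₁ b₂ : ℝ)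
    (hX : ∀ p ∈ (uIcc a₁ b₁) ×ˢ (uIcc a₂ b₂), ContDiffAt ℝ 2 X p)
    (hY : ∀ p ∈ (uIcc a₁ b₁) ×ˢ (uIcc a₂ b₂), ContDiffAt ℝ 2 Y p) :
    (∫ x in a₁..b₁, ∫ y in a₂..b₂, (fderiv ℝ Y (x, y) (1, 0) * fderiv ℝ X (x, y) (0, 1) -
        fderiv ℝ Y (x, y) (0, 1) * fderiv ℝ X (x, y) (1, 0))) =
      (((∫ x in a₁..b₁, -(Y (x, b₂) * fderiv ℝ X (x, b₂) (1, 0))) -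
          ∫ x in a₁..b₁, -(Y (x, a₂) * fderiv ℝ X (x, a₂) (1, 0))) +
        ∫ y in a₂..b₂, Y (b₁, y) * fderiv ℝ X (b₁, y) (0, 1)) -
      ∫ y in a₂..b₂, Y (a₁, y) * fderiv ℝ X (a₁, y) (0, 1) := by
  have hX1 : ∀ p ∈ (uIcc a₁ b₁) ×ˢ (uIcc a₂ b₂), ContDiffAt ℝ 1 (fderiv ℝ X) p :=
    fun p hp => (hX p hp).fderiv_right (by norm_num)
  have hYd : ∀ p ∈ (uIcc a₁ b₁) ×ˢ (uIcc a₂ b₂), DifferentiableAt ℝ Y p :=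
    fun p hp => (hY p hp).differentiableAt (by norm_num)
  have hXd : ∀ p ∈ (uIcc a₁ b₁) ×ˢ (uIcc a₂ b₂), DifferentiableAt ℝ (fderiv ℝ X) p :=
    fun p hp => (hX1 p hp).differentiableAt (by norm_num)
  have hf : ∀ v, ∀ p ∈ (uIcc a₁ b₁) ×ˢ (uIcc a₂ b₂),
      ContDiffAt ℝ 1 (fun p => Y p * fderiv ℝ X p v) p := fun v p hp =>
    ((hY p hp).of_le (by norm_num)).mul ((hX1 p hp).clm_apply contDiffAt_const)
  have hg : ∀ v, ∀ p ∈ (uIcc a₁ b₁) ×ˢ (uIcc a₂ b₂),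
      ContDiffAt ℝ 1 (fun p => -(Y p * fderiv ℝ X p v)) p := fun v p hp => (hf v p hp).neg
  have hfd : ∀ v w, ∀ p ∈ (uIcc a₁ b₁) ×ˢ (uIcc a₂ b₂),
      fderiv ℝ (fun p => Y p * fderiv ℝ X p v) p w =
        fderiv ℝ Y p w * fderiv ℝ X p v + Y p * fderiv ℝ (fderiv ℝ X) p w v := by
    intro v w p hp
    have h1 : HasFDerivAt (fun p => fderiv ℝ X p v) _ p :=
      (hXd p hp).hasFDerivAt.clm_apply (hasFDerivAt_const v p)
    have h2 : HasFDerivAt (fun p => Y p * fderiv ℝ X p v) _ p := (hYd p hp).hasFDerivAt.mul h1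
    rw [h2.fderiv]
    simp
    ring
  have hsym : ∀ p ∈ (uIcc a₁ b₁) ×ˢ (uIcc a₂ b₂),
      fderiv ℝ (fderiv ℝ X) p (1, 0) (0, 1) = fderiv ℝ (fderiv ℝ X) p (0, 1) (1, 0) := by
    intro p hp
    exact ((hX p hp).isSymmSndFDerivAt (by simp)) _ _
  -- d(Y dX) = dY ∧ dX: the second derivatives of X cancel by symmetry.
  have hdiv : ∀ p ∈ (uIcc a₁ b₁) ×ˢ (uIcc a₂ b₂),
      fderiv ℝ (fun p => Y p * fderiv ℝ X p (0, 1)) p (1, 0) +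
        fderiv ℝ (fun p => -(Y p * fderiv ℝ X p (1, 0))) p (0, 1) =
      fderiv ℝ Y p (1, 0) * fderiv ℝ X p (0, 1) - fderiv ℝ Y p (0, 1) * fderiv ℝ X p (1, 0) := by
    intro p hp
    rw [fderiv_fun_neg, neg_apply, hfd _ _ p hp, hfd _ _ p hp, hsym p hp]
    ring
  have hsub : Ioo (min a₁ b₁) (max a₁ b₁) ×ˢ Ioo (min a₂ b₂) (max a₂ b₂) ⊆
      (uIcc a₁ b₁) ×ˢ (uIcc a₂ b₂) := prod_mono Ioo_subset_Icc_self Ioo_subset_Icc_self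
  rw [← integral2_divergence_prod_of_hasFDerivAt (fun p => Y p * fderiv ℝ X p (0, 1))
    (fun p => -(Y p * fderiv ℝ X p (1, 0))) (fderiv ℝ _) (fderiv ℝ _) a₁ a₂ b₁ b₂
    (fun p hp => (hf _ p hp).continuousAt.continuousWithinAt)
    (fun p hp => (hg _ p hp).continuousAt.continuousWithinAt)
    (fun p hp => ((hf _ p (hsub hp)).differentiableAt (by norm_num)).hasFDerivAt)
    (fun p hp => ((hg _ p (hsub hp)).differentiableAt (by norm_num)).hasFDerivAt) ?_]
  · refine intervalIntegral.integral_congr fun x hx => ?_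
    refine intervalIntegral.integral_congr fun y hy => ?_
    exact (hdiv (x, y) ⟨hx, hy⟩).symm
  · refine ContinuousOn.integrableOn_compact (isCompact_uIcc.prod isCompact_uIcc) fun p hp => ?_
    refine ContinuousAt.continuousWithinAt ?_
    have h1 := ((hf (0, 1) p hp).fderiv_right (m := 0) (by norm_num)).continuousAt
    have h2 := ((hg (1, 0) p hp).fderiv_right (m := 0) (by norm_num)).continuousAt
    exact (h1.clm_apply continuousAt_const).add (h2.clm_apply continuousAt_const)

/-- The determinant of a real linear map of the plane in a rotated basis. -/
theorem det_eq_of_norm_eq_one (L : ℂ →L[ℝ] ℂ) (e : ℂ) (he : ‖e‖ = 1) :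
    L.det = (L e).re * (L (e * Complex.I)).im - (L e).im * (L (e * Complex.I)).re := by
  have h1 : L.det = (L 1).re * (L Complex.I).im - (L 1).im * (L Complex.I).re := by
    rw [ContinuousLinearMap.det, ← LinearMap.det_toMatrix Complex.basisOneI, Matrix.det_fin_two]
    simp [LinearMap.toMatrix_apply]
    ring
  have h2 : e = e.re • (1 : ℂ) + e.im • Complex.I := by
    apply Complex.ext <;> simp
  have h3 : e * Complex.I = (-e.im) • (1 : ℂ) + e.re • Complex.I := by
    apply Complex.ext <;> simp
  have h4 : e.re * e.re + e.im * e.im = 1 := by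
    have := Complex.normSq_apply e
    rw [Complex.normSq_eq_norm_sq, he] at this
    linarith
  have h5 : L e = e.re • L 1 + e.im • L Complex.I := by
    conv_lhs => rw [h2]
    rw [map_add, map_smul, map_smul]
  rw [h1, h3, map_add, map_smul, map_smul, h5]
  simp
  linear_combination (-((L 1).re * (L Complex.I).im - (L 1).im * (L Complex.I).re)) * h4

/-- Polar coordinates. -/
def polar (p : ℝ × ℝ) : ℂ := p.1 * Complex.exp (p.2 * Complex.I)

theorem contDiff_polar : ContDiff ℝ 2 polar := by
  have h1 : ContDiff ℝ 2 fun p : ℝ × ℝ => (p.1 : ℂ) := Complex.ofRealCLM.contDiff.comp contDiff_fst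
  have h2 : ContDiff ℝ 2 fun p : ℝ × ℝ => (p.2 : ℂ) := Complex.ofRealCLM.contDiff.comp contDiff_snd
  exact h1.mul ((h2.mul contDiff_const).cexp)

theorem norm_polar (p : ℝ × ℝ) : ‖polar p‖ = |p.1| := by
  simp [polar, Complex.norm_exp_ofReal_mul_I]

theorem hasFDerivAt_polar (p : ℝ × ℝ) : ∃ L : ℝ × ℝ →L[ℝ] ℂ, HasFDerivAt polar L p ∧
    L (1, 0) = Complex.exp (p.2 * Complex.I) ∧ L (0, 1) = polar p * Complex.I := by
  have h1 : HasFDerivAt (fun p : ℝ × ℝ => (p.1 : ℂ))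
      (Complex.ofRealCLM.comp (ContinuousLinearMap.fst ℝ ℝ ℝ)) p :=
    (Complex.ofRealCLM.comp (ContinuousLinearMap.fst ℝ ℝ ℝ)).hasFDerivAt
  have h2 : HasFDerivAt (fun p : ℝ × ℝ => (p.2 : ℂ))
      (Complex.ofRealCLM.comp (ContinuousLinearMap.snd ℝ ℝ ℝ)) p :=
    (Complex.ofRealCLM.comp (ContinuousLinearMap.snd ℝ ℝ ℝ)).hasFDerivAt
  have h3 := h1.mul ((h2.mul_const Complex.I).cexp)
  refine ⟨_, h3, ?_, ?_⟩
  · simp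
  · simp [polar]; ring

/-- The integral of the pullback of `y dx` over a circle inside the disk is nonpositive. -/
theorem integral_circle_nonpos {u : ℂ → ℂ} (hu : ContDiffOn ℝ 2 u (Metric.ball 0 1))
    (hdet : ∀ w ∈ Metric.ball (0 : ℂ) 1, 0 ≤ (fderiv ℝ u w).det) {r : ℝ} (hr0 : 0 ≤ r)
    (hr1 : r < 1) :
    ∫ θ in (0 : ℝ)..2 * Real.pi,
      (u (polar (r, θ))).im * (fderiv ℝ u (polar (r, θ)) (polar (r, θ) * Complex.I)).re ≤ 0 := by
  have hmem : ∀ p : ℝ × ℝ, |p.1| < 1 → polar p ∈ Metric.ball (0 : ℂ) 1 := by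
    intro p hp
    rwa [mem_ball_zero_iff, norm_polar]
  have hW : ∀ p : ℝ × ℝ, |p.1| < 1 → ContDiffAt ℝ 2 (fun p => u (polar p)) p := by
    intro p hp
    exact (hu.contDiffAt (Metric.isOpen_ball.mem_nhds (hmem p hp))).comp p contDiff_polar.contDiffAt
  have hud : ∀ p : ℝ × ℝ, |p.1| < 1 → HasFDerivAt u (fderiv ℝ u (polar p)) (polar p) := fun p hp =>
    ((hu.contDiffAt (Metric.isOpen_ball.mem_nhds (hmem p hp))).differentiableAt
      (by norm_num)).hasFDerivAt
  let X : ℝ × ℝ → ℝ := fun p => (u (polar p)).re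
  let Y : ℝ × ℝ → ℝ := fun p => (u (polar p)).im
  have hX : ∀ p : ℝ × ℝ, |p.1| < 1 → ContDiffAt ℝ 2 X p := fun p hp =>
    Complex.reCLM.contDiff.contDiffAt.comp p (hW p hp)
  have hY : ∀ p : ℝ × ℝ, |p.1| < 1 → ContDiffAt ℝ 2 Y p := fun p hp =>
    Complex.imCLM.contDiff.contDiffAt.comp p (hW p hp)
  have hd : ∀ p : ℝ × ℝ, |p.1| < 1 →
      fderiv ℝ X p (1, 0) = (fderiv ℝ u (polar p) (Complex.exp (p.2 * Complex.I))).re ∧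
      fderiv ℝ Y p (1, 0) = (fderiv ℝ u (polar p) (Complex.exp (p.2 * Complex.I))).im ∧
      fderiv ℝ X p (0, 1) = (fderiv ℝ u (polar p) (polar p * Complex.I)).re ∧
      fderiv ℝ Y p (0, 1) = (fderiv ℝ u (polar p) (polar p * Complex.I)).im := by
    intro p hp
    obtain ⟨L, hL, h10, h01⟩ := hasFDerivAt_polar p
    have hWd : HasFDerivAt (fun p => u (polar p)) _ p := (hud p hp).comp p hL
    have hXd : HasFDerivAt X _ p := Complex.reCLM.hasFDerivAt.comp p hWd
    have hYd : HasFDerivAt Y _ p := Complex.imCLM.hasFDerivAt.comp p hWd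
    rw [hXd.fderiv, hYd.fderiv]
    simp [h10, h01]
  have habs : ∀ x ∈ (uIcc (0 : ℝ) r), |x| < 1 := by
    intro x hx
    rw [uIcc_of_le hr0] at hx
    rw [abs_of_nonneg hx.1]
    exact hx.2.trans_lt hr1
  have key := integral_rectangle_pullback X Y 0 0 r (2 * Real.pi)
    (fun p hp => hX p (habs _ hp.1)) (fun p hp => hY p (habs _ hp.1))
  have hper : ∀ x : ℝ, polar (x, 2 * Real.pi) = polar (x, 0) := by
    intro x
    simp [polar, Complex.exp_two_pi_mul_I]
  -- The rays at angles 0 and 2π coincide and cancel, and the side of radius 0 collapses to a point.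
  -- Only the circle of radius r remains.
  have e1 : (∫ x in (0 : ℝ)..r, -(Y (x, 2 * Real.pi) * fderiv ℝ X (x, 2 * Real.pi) (1, 0))) =
      ∫ x in (0 : ℝ)..r, -(Y (x, 0) * fderiv ℝ X (x, 0) (1, 0)) := by
    refine intervalIntegral.integral_congr fun x hx => ?_
    change -((u (polar _)).im * _) = -((u (polar _)).im * _)
    rw [(hd (x, 2 * Real.pi) (habs _ hx)).1, (hd (x, 0) (habs _ hx)).1, hper]
    simp [Complex.exp_two_pi_mul_I]
  have e2 : (∫ y in (0 : ℝ)..2 * Real.pi, Y (0, y) * fderiv ℝ X (0, y) (0, 1)) = 0 := by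
    refine (intervalIntegral.integral_congr fun y _ => ?_).trans intervalIntegral.integral_zero
    rw [(hd (0, y) (by simp)).2.2.1]
    simp [polar]
  have e3 : (∫ y in (0 : ℝ)..2 * Real.pi, Y (r, y) * fderiv ℝ X (r, y) (0, 1)) =
      ∫ θ in (0 : ℝ)..2 * Real.pi, (u (polar (r, θ))).im *
        (fderiv ℝ u (polar (r, θ)) (polar (r, θ) * Complex.I)).re := by
    refine intervalIntegral.integral_congr fun y _ => ?_
    rw [(hd (r, y) (by simpa [abs_of_nonneg hr0] using hr1)).2.2.1]
  rw [e1, e2, e3, sub_self, zero_add, sub_zero] at key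
  -- The integrand is -x det(du) at radius x, whence the sign.
  rw [← key, ← neg_nonneg, ← intervalIntegral.integral_neg]
  refine intervalIntegral.integral_nonneg hr0 fun x hx => ?_
  rw [← intervalIntegral.integral_neg]
  refine intervalIntegral.integral_nonneg (by positivity) fun y _ => ?_
  have hx1 : |x| < 1 := habs x (by rwa [uIcc_of_le hr0])
  obtain ⟨h1, h2, h3, h4⟩ := hd (x, y) hx1
  rw [h1, h2, h3, h4]
  have h5 : polar (x, y) * Complex.I = x • (Complex.exp (y * Complex.I) * Complex.I) := by
    simp [polar, mul_assoc]
  have h6 := det_eq_of_norm_eq_one (fderiv ℝ u (polar (x, y))) (Complex.exp (y * Complex.I))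
    (Complex.norm_exp_ofReal_mul_I y)
  have h7 := mul_nonneg hx.1 (hdet _ (hmem (x, y) hx1))
  rw [h6] at h7
  rw [h5, map_smul]
  simp only [Complex.smul_re, Complex.smul_im, smul_eq_mul]
  linarith

/-- The integral of the pullback of `y dx` over the boundary of the disk is nonpositive, for a map
that is Lipschitz on the disk and smooth away from a set `P` of boundary points. -/
theorem integral_boundary_nonpos {u : ℂ → ℂ} {P : Set ℂ} (hP : P.Finite)
    (hPs : ∀ w ∈ P, ‖w‖ = 1) {C : NNReal} (hlip : LipschitzOnWith C u (Metric.closedBall 0 1))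
    (hu : ContDiffOn ℝ ∞ u (Metric.closedBall 0 1 \ P))
    (hdet : ∀ w ∈ Metric.closedBall (0 : ℂ) 1 \ P,
      0 ≤ (fderivWithin ℝ u (Metric.closedBall 0 1) w).det)
    (hae : ∀ᵐ θ : ℝ, θ ∈ uIoc 0 (2 * Real.pi) → Complex.exp (θ * Complex.I) ∉ P) :
    IntervalIntegrable (fun θ : ℝ => (u (Complex.exp (θ * Complex.I))).im *
        (fderivWithin ℝ u (Metric.closedBall 0 1) (Complex.exp (θ * Complex.I))
          (Complex.exp (θ * Complex.I) * Complex.I)).re) volume 0 (2 * Real.pi) ∧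
      ∫ θ in (0 : ℝ)..2 * Real.pi, (u (Complex.exp (θ * Complex.I))).im *
        (fderivWithin ℝ u (Metric.closedBall 0 1) (Complex.exp (θ * Complex.I))
          (Complex.exp (θ * Complex.I) * Complex.I)).re ≤ 0 := by
  set D : ℂ → ℂ →L[ℝ] ℂ := fderivWithin ℝ u (Metric.closedBall 0 1) with hD
  have hball : Metric.ball (0 : ℂ) 1 ⊆ Metric.closedBall 0 1 \ P := fun w hw =>
    ⟨Metric.ball_subset_closedBall hw, fun hwP => by
      rw [mem_ball_zero_iff, hPs w hwP] at hw; exact lt_irrefl _ hw⟩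
  have hDball : ∀ w ∈ Metric.ball (0 : ℂ) 1, D w = fderiv ℝ u w := fun w hw =>
    fderivWithin_of_mem_nhds (Filter.mem_of_superset (Metric.isOpen_ball.mem_nhds hw)
      Metric.ball_subset_closedBall)
  have huniq : UniqueDiffOn ℝ (Metric.closedBall (0 : ℂ) 1) :=
    uniqueDiffOn_convex (convex_closedBall _ _) (by
      rw [interior_closedBall _ one_ne_zero]; exact ⟨0, by simp⟩)
  have hDcont : ContinuousOn D (Metric.closedBall 0 1 \ P) := by
    have h1 : ContinuousOn (fderivWithin ℝ u (Metric.closedBall 0 1 \ P))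
        (Metric.closedBall 0 1 \ P) :=
      hu.continuousOn_fderivWithin (huniq.inter hP.isClosed.isOpen_compl) (by simp)
    refine h1.congr fun w hw => ?_
    exact (fderivWithin_inter (hP.isClosed.isOpen_compl.mem_nhds hw.2)).symm
  obtain ⟨B, hB⟩ := (isCompact_closedBall (0 : ℂ) 1).exists_bound_of_continuousOn hlip.continuousOn
  -- The Lipschitz constant bounds the derivative uniformly up to the punctures; this is the
  -- dominating bound as the circles of radius `r n` tend to the boundary.
  have hDb : ∀ w ∈ Metric.ball (0 : ℂ) 1, ‖D w‖ ≤ C := by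
    intro w hw
    rw [hDball w hw]
    exact norm_fderiv_le_of_lipschitzOn ℝ (Filter.mem_of_superset
      (Metric.isOpen_ball.mem_nhds hw) Metric.ball_subset_closedBall) hlip
  let G : ℂ → ℝ := fun w => (u w).im * (D w (w * Complex.I)).re
  have hGcont : ContinuousOn G (Metric.closedBall 0 1 \ P) := by
    refine (Complex.continuous_im.comp_continuousOn hu.continuousOn).mul
      (Complex.continuous_re.comp_continuousOn (hDcont.clm_apply ?_))
    exact (continuous_id.mul continuous_const).continuousOn
  have hGb : ∀ w ∈ Metric.ball (0 : ℂ) 1, ‖G w‖ ≤ B * C := by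
    intro w hw
    have h1 : |(u w).im| ≤ B :=
      (Complex.abs_im_le_norm _).trans (hB w (Metric.ball_subset_closedBall hw))
    have h2 : |(D w (w * Complex.I)).re| ≤ C := by
      refine (Complex.abs_re_le_norm _).trans (((D w).le_opNorm _).trans ?_)
      have : ‖w * Complex.I‖ ≤ 1 := by
        rw [norm_mul, Complex.norm_I, mul_one]
        exact (mem_ball_zero_iff.1 hw).le
      calc ‖D w‖ * ‖w * Complex.I‖ ≤ C * 1 :=
            mul_le_mul (hDb w hw) this (norm_nonneg _) C.coe_nonneg
        _ = C := mul_one _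
    rw [Real.norm_eq_abs, abs_mul]
    exact mul_le_mul h1 h2 (abs_nonneg _) ((abs_nonneg _).trans h1)
  let r : ℕ → ℝ := fun n => 1 - 1 / ((n : ℝ) + 1)
  have hr0 : ∀ n, 0 ≤ r n := by
    intro n
    have : 1 / ((n : ℝ) + 1) ≤ 1 := by
      rw [div_le_one (by positivity)]; linarith [n.cast_nonneg (α := ℝ)]
    simp only [r]; linarith
  have hr1 : ∀ n, r n < 1 := by
    intro n
    have : 0 < 1 / ((n : ℝ) + 1) := by positivity
    simp only [r]; linarith
  have hrt : Tendsto r atTop (𝓝 1) := by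
    have := (tendsto_const_nhds (x := (1 : ℝ))).sub (tendsto_one_div_add_atTop_nhds_zero_nat (𝕜 := ℝ))
    simpa [r] using this
  have hmem : ∀ n θ, polar (r n, θ) ∈ Metric.ball (0 : ℂ) 1 := by
    intro n θ
    rw [mem_ball_zero_iff, norm_polar, abs_of_nonneg (hr0 n)]
    exact hr1 n
  have hc : ∀ n, Continuous fun θ => G (polar (r n, θ)) := by
    intro n
    refine hGcont.comp_continuous (contDiff_polar.continuous.comp (by fun_prop)) fun θ => ?_
    exact hball (hmem n θ)
  have hlim : ∀ θ : ℝ, Complex.exp (θ * Complex.I) ∉ P →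
      Tendsto (fun n => G (polar (r n, θ))) atTop (𝓝 (G (Complex.exp (θ * Complex.I)))) := by
    intro θ hθ
    have h1 : Tendsto (fun n => polar (r n, θ)) atTop (𝓝 (Complex.exp (θ * Complex.I))) := by
      have h : Tendsto (fun n => (r n, θ)) atTop (𝓝 ((1 : ℝ), θ)) := hrt.prodMk_nhds tendsto_const_nhds
      have := (contDiff_polar.continuous.tendsto (1, θ)).comp h
      simpa [polar, Function.comp_def] using this
    have hw : Complex.exp (θ * Complex.I) ∈ Metric.closedBall (0 : ℂ) 1 \ P :=
      ⟨by simp [Complex.norm_exp_ofReal_mul_I], hθ⟩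
    exact (hGcont _ hw).tendsto.comp
      (tendsto_nhdsWithin_iff.2 ⟨h1, Eventually.of_forall fun n => hball (hmem n θ)⟩)
  have hae' : ∀ᵐ θ : ℝ ∂volume.restrict (uIoc 0 (2 * Real.pi)),
      Tendsto (fun n => G (polar (r n, θ))) atTop (𝓝 (G (Complex.exp (θ * Complex.I)))) := by
    rw [ae_restrict_iff' measurableSet_uIoc]
    filter_upwards [hae] with θ hθ hm using hlim θ (hθ hm)
  have hint := intervalIntegral.tendsto_integral_filter_of_dominated_convergence
    (μ := volume) (a := 0) (b := 2 * Real.pi) (l := atTop)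
    (F := fun n θ => G (polar (r n, θ))) (f := fun θ => G (Complex.exp (θ * Complex.I)))
    (fun _ => B * C) (Eventually.of_forall fun n => (hc n).aestronglyMeasurable)
    (Eventually.of_forall fun n => Eventually.of_forall fun θ _ => hGb _ (hmem n θ))
    intervalIntegrable_const (by filter_upwards [hae] with θ hθ hm using hlim θ (hθ hm))
  constructor
  · rw [intervalIntegrable_iff]
    have : IsFiniteMeasure (volume.restrict (uIoc 0 (2 * Real.pi))) :=
      ⟨by rw [Measure.restrict_apply_univ, uIoc]; exact measure_Ioc_lt_top⟩
    refine Integrable.of_bound ?_ (B * C) ?_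
    · exact aestronglyMeasurable_of_tendsto_ae atTop
        (fun n => (hc n).aestronglyMeasurable) hae'
    · filter_upwards [hae'] with θ hθ
      exact le_of_tendsto hθ.norm (Eventually.of_forall fun n => hGb _ (hmem n θ))
  · refine le_of_tendsto hint (Eventually.of_forall fun n => ?_)
    have h := integral_circle_nonpos (u := u) ((hu.mono hball).of_le (WithTop.coe_le_coe.2 (le_top : (2 : ℕ∞) ≤ ⊤)))
      (fun w hw => by rw [← hDball w hw]; exact hdet w (hball hw)) (hr0 n) (hr1 n)
    refine le_trans (le_of_eq ?_) h
    refine intervalIntegral.integral_congr fun θ _ => ?_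
    simp only [G, hDball _ (hmem n θ)]

end Stokes

/-! ### The height filtration of the Chekanov–Eliashberg DGA -/

namespace LegendrianKnot

open MeasureTheory Set Filter Topology

variable {Λ : LegendrianKnot}

/-- The height of a Reeb chord. -/
def ReebChord.height (a : Λ.ReebChord) : ℝ := Λ.z a.upper - Λ.z a.lower

theorem ReebChord.height_pos (a : Λ.ReebChord) : 0 < a.height := sub_pos.2 a.2.2.2.2.2

theorem z_eq_of_samePoint {s s' : ℝ} (h : SamePoint s s') : Λ.z s' = Λ.z s := by
  obtain ⟨n, rfl⟩ := h
  have := Λ.periodic_z.int_mul n s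
  rwa [mul_one] at this

variable {a : Λ.ReebChord}

theorem Disk.φ_castSucc_mem (D : Λ.Disk a) (i : Fin (D.l + 1)) :
    D.φ i.castSucc ∈ Ico 0 (2 * Real.pi) := by
  constructor
  · rw [← D.φ_zero]; exact D.φ_mono.monotone (Fin.zero_le _)
  · rw [← D.φ_last]; exact D.φ_mono (Fin.castSucc_lt_last i)

/-- The puncture at angle 0 reappears at 2π, which is the last value of `φ` though not of the form
`φ i.castSucc`; excluding all of `range D.φ` covers it. -/
theorem Disk.exp_notMem (D : Λ.Disk a) {θ : ℝ} (hθ : θ ∈ Ioc 0 (2 * Real.pi))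
    (h : θ ∉ range D.φ) : Complex.exp (θ * Complex.I) ∉
      range fun i : Fin (D.l + 1) => Complex.exp (D.φ i.castSucc * Complex.I) := by
  rintro ⟨i, hi⟩
  obtain ⟨n, hn⟩ := Complex.exp_eq_exp_iff_exists_int.1 hi
  have h1 : D.φ i.castSucc = θ + n * (2 * Real.pi) := by
    have h2 : ((D.φ i.castSucc : ℝ) : ℂ) * Complex.I =
        ((θ + n * (2 * Real.pi) : ℝ) : ℂ) * Complex.I := by
      rw [hn]; push_cast; ring
    exact_mod_cast mul_right_cancel₀ Complex.I_ne_zero h2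
  have h3 := D.φ_castSucc_mem i
  have hpi := Real.two_pi_pos
  rw [h1] at h3
  have hn0 : n ≤ 0 := by
    by_contra hc
    have : (1 : ℝ) ≤ n := by exact_mod_cast not_le.1 hc
    nlinarith [h3.2, hθ.1]
  rcases hn0.lt_or_eq with hn1 | rfl
  · have h4 : (n : ℝ) ≤ -1 := by exact_mod_cast Int.le_sub_one_of_lt hn1
    have h5 : θ = 2 * Real.pi := le_antisymm hθ.2 (by nlinarith [h3.1])
    exact h ⟨Fin.last _, by rw [D.φ_last, h5]⟩
  · exact h ⟨i.castSucc, by simpa using h1⟩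

/-- The pullback of the form `y dx` to the circle at the angle `θ`. -/
def Disk.boundaryForm (D : Λ.Disk a) (θ : ℝ) : ℝ :=
  (D.u (Complex.exp (θ * Complex.I))).im *
    (fderivWithin ℝ D.u (Metric.closedBall 0 1) (Complex.exp (θ * Complex.I))
      (Complex.exp (θ * Complex.I) * Complex.I)).re

theorem Disk.integral_boundaryForm_nonpos (D : Λ.Disk a) :
    IntervalIntegrable D.boundaryForm volume 0 (2 * Real.pi) ∧
      ∫ θ in (0 : ℝ)..2 * Real.pi, D.boundaryForm θ ≤ 0 := by
  obtain ⟨C, hC⟩ := D.lipschitz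
  refine integral_boundary_nonpos (finite_range _) ?_ hC D.smooth
    (fun w hw => (D.immersed w hw).le) ?_
  · rintro _ ⟨i, rfl⟩
    exact Complex.norm_exp_ofReal_mul_I _
  · filter_upwards [(finite_range D.φ).countable.ae_notMem volume] with θ hθ hm
    rw [uIoc_of_le (by positivity)] at hm
    exact D.exp_notMem hm hθ

/-- The Legendrian condition dz = y dx along the lift, with dx computed a second time as the real
part of the derivative of u along the circle. -/
theorem Disk.hasDerivAt_z_lift (D : Λ.Disk a) (i : Fin (D.l + 1)) {θ : ℝ}
    (hθ : θ ∈ Ioo (D.φ i.castSucc) (D.φ i.succ)) :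
    HasDerivAt (fun θ => Λ.z (D.lift i θ)) (D.boundaryForm θ) θ := by
  have hIcc : Icc (D.φ i.castSucc) (D.φ i.succ) ∈ 𝓝 θ := Icc_mem_nhds hθ.1 hθ.2
  have hl : HasDerivAt (D.lift i) (deriv (D.lift i) θ) θ :=
    (((D.lift_smooth i).contDiffAt (isOpen_Ioo.mem_nhds hθ)).differentiableAt
      (by simp)).hasDerivAt
  have hz : HasDerivAt (fun θ => Λ.z (D.lift i θ)) _ θ :=
    ((Λ.smooth_z.differentiable (by simp)) (D.lift i θ)).hasDerivAt.comp θ hl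
  have hx : HasDerivAt (fun θ => Λ.x (D.lift i θ)) _ θ :=
    ((Λ.smooth_x.differentiable (by simp)) (D.lift i θ)).hasDerivAt.comp θ hl
  have h0 : 0 < θ := (D.φ_castSucc_mem i).1.trans_lt hθ.1
  have h2 : θ ≤ 2 * Real.pi := by
    rw [← D.φ_last]; exact hθ.2.le.trans (D.φ_mono.monotone (Fin.le_last _))
  have hr : θ ∉ range D.φ := by
    rintro ⟨j, rfl⟩
    have h3 := D.φ_mono.lt_iff_lt.1 hθ.1
    have h4 := D.φ_mono.lt_iff_lt.1 hθ.2
    rw [Fin.lt_def] at h3 h4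
    simp at h3 h4
    omega
  have hP := D.exp_notMem ⟨h0, h2⟩ hr
  set w := Complex.exp (θ * Complex.I) with hw
  set P := range fun i : Fin (D.l + 1) => Complex.exp (D.φ i.castSucc * Complex.I)
  have hwS : w ∈ Metric.closedBall (0 : ℂ) 1 \ P :=
    ⟨by simp [hw, Complex.norm_exp_ofReal_mul_I], hP⟩
  have hd : DifferentiableWithinAt ℝ D.u (Metric.closedBall 0 1) w :=
    (differentiableWithinAt_inter ((finite_range _).isClosed.isOpen_compl.mem_nhds hP)).1
      (((D.smooth) w hwS).differentiableWithinAt (by simp))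
  have he : HasDerivAt (fun θ : ℝ => Complex.exp (θ * Complex.I)) (w * Complex.I) θ := by
    have := (((hasDerivAt_id θ).ofReal_comp).mul_const Complex.I).cexp
    simpa using this
  have hu : HasDerivAt (fun θ : ℝ => D.u (Complex.exp (θ * Complex.I))) _ θ :=
    hd.hasFDerivWithinAt.comp_hasDerivAt θ he
      (Eventually.of_forall fun t => by simp [Complex.norm_exp_ofReal_mul_I])
  have hre : HasDerivAt (fun θ : ℝ => (D.u (Complex.exp (θ * Complex.I))).re) _ θ :=
    Complex.reCLM.hasFDerivAt.comp_hasDerivAt θ hu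
  have hx' : (fun θ => Λ.x (D.lift i θ)) =ᶠ[𝓝 θ]
      fun θ : ℝ => (D.u (Complex.exp (θ * Complex.I))).re := by
    filter_upwards [hIcc] with t ht
    rw [D.boundary i t ht]; rfl
  have key := hx.unique (hre.congr_of_eventuallyEq hx')
  have hy : (D.u w).im = Λ.y (D.lift i θ) := by
    rw [hw, D.boundary i θ ⟨hθ.1.le, hθ.2.le⟩]; rfl
  convert hz using 1
  rw [Disk.boundaryForm, ← hw, hy, Λ.legendrian, mul_assoc, key]
  rfl

/-- The lift is smooth only inside the arc, so the fundamental theorem is used with mere continuity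
at the corners. -/
theorem Disk.integral_boundaryForm_arc (D : Λ.Disk a) (i : Fin (D.l + 1)) :
    ∫ θ in D.φ i.castSucc..D.φ i.succ, D.boundaryForm θ =
      Λ.z (D.lift i (D.φ i.succ)) - Λ.z (D.lift i (D.φ i.castSucc)) := by
  have hle : D.φ i.castSucc ≤ D.φ i.succ := (D.φ_mono Fin.castSucc_lt_succ).le
  refine intervalIntegral.integral_eq_sub_of_hasDerivAt_of_le
    (f := fun θ => Λ.z (D.lift i θ)) hle
    (Λ.smooth_z.continuous.comp_continuousOn (D.lift_continuous i))
    (fun θ hθ => D.hasDerivAt_z_lift i hθ) ?_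
  refine D.integral_boundaryForm_nonpos.1.mono_set ?_
  rw [uIcc_of_le hle, uIcc_of_le (by positivity)]
  refine Icc_subset_Icc (D.φ_castSucc_mem i).1 ?_
  rw [← D.φ_last]; exact D.φ_mono.monotone (Fin.le_last _)

/-- The height of the positive corner of a disk is at least the total height of the negative
corners. -/
theorem Disk.sum_height_le (D : Λ.Disk a) : ∑ j, (D.b j).height ≤ a.height := by
  -- The subdivision extended to ℕ, as adding adjacent integrals requires; the value 0 is never
  -- used.
  let p : ℕ → ℝ := fun n => if h : n < D.l + 2 then D.φ ⟨n, h⟩ else 0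
  have hp : ∀ i : Fin (D.l + 2), p i = D.φ i := fun i => dif_pos i.2
  have hint : ∀ n < D.l + 1, IntervalIntegrable D.boundaryForm volume (p n) (p (n + 1)) := by
    intro n hn
    have h1 := hp (⟨n, hn⟩ : Fin (D.l + 1)).castSucc
    have h2 := hp (⟨n, hn⟩ : Fin (D.l + 1)).succ
    simp only [Fin.val_castSucc, Fin.val_succ] at h1 h2
    rw [h1, h2]
    have hle : D.φ (⟨n, hn⟩ : Fin (D.l + 1)).castSucc ≤ D.φ (⟨n, hn⟩ : Fin (D.l + 1)).succ :=
      (D.φ_mono Fin.castSucc_lt_succ).le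
    refine D.integral_boundaryForm_nonpos.1.mono_set ?_
    rw [uIcc_of_le hle, uIcc_of_le (by positivity)]
    refine Icc_subset_Icc (D.φ_castSucc_mem _).1 ?_
    rw [← D.φ_last]; exact D.φ_mono.monotone (Fin.le_last _)
  have hsum := intervalIntegral.sum_integral_adjacent_intervals hint
  rw [Finset.sum_range] at hsum
  have h0 : p 0 = 0 := (hp 0).trans D.φ_zero
  have hl : p (D.l + 1) = 2 * Real.pi := (hp (Fin.last _)).trans D.φ_last
  have hsum' : ∑ i : Fin (D.l + 1), (Λ.z (D.lift i (D.φ i.succ)) -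
      Λ.z (D.lift i (D.φ i.castSucc))) ≤ 0 := by
    refine le_trans (le_of_eq ?_) D.integral_boundaryForm_nonpos.2
    rw [h0, hl] at hsum
    rw [← hsum]
    refine Finset.sum_congr rfl fun i _ => ?_
    rw [← D.integral_boundaryForm_arc, ← hp, ← hp]
    rfl
  -- Splitting the last endpoint and the first starting point off pairs the rest by corner: each
  -- negative corner contributes its height, the positive one minus its height.
  rw [Finset.sum_sub_distrib, Fin.sum_univ_castSucc, Fin.sum_univ_succ] at hsum'
  have e1 : Λ.z (D.lift (Fin.last D.l) (D.φ (Fin.last D.l).succ)) = Λ.z a.lower :=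
    z_eq_of_samePoint D.pos_in
  have e2 : Λ.z (D.lift 0 (D.φ (Fin.castSucc 0))) = Λ.z a.upper := z_eq_of_samePoint D.pos_out
  have e3 : ∀ j : Fin D.l, Λ.z (D.lift j.castSucc (D.φ j.castSucc.succ)) = Λ.z (D.b j).upper :=
    fun j => z_eq_of_samePoint (D.neg_in j)
  have e4 : ∀ j : Fin D.l, Λ.z (D.lift j.succ (D.φ j.succ.castSucc)) = Λ.z (D.b j).lower :=
    fun j => z_eq_of_samePoint (D.neg_out j)
  simp only [e1, e2, e3, e4] at hsum'
  simp only [ReebChord.height, Finset.sum_sub_distrib]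
  linarith

theorem tPow_eq_word (n : ℤ) : tPow Λ n = word (.inr (FreeGroup.of () ^ n)) := by
  have : (tUnit () ^ n : (SFAlg Λ.ReebChord Unit)ˣ) =
      Units.map (MonoidAlgebra.of ℤ (SFMonoid Λ.ReebChord Unit))
        (Units.map (Monoid.Coprod.inr : FreeGroup Unit →* SFMonoid Λ.ReebChord Unit)
          (toUnits (FreeGroup.of () ^ n))) := by
    rw [map_zpow, map_zpow, map_zpow]; rfl
  rw [tPow, this]; rfl

/-- The weight is an integer multiple of one word, whose chords are the negative corners and whose
letters t have height 0. -/
theorem Disk.wordHeight_le (D : Λ.Disk a) (base : ℝ) (side : Λ.ReebChord → Bool)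
    (w : SFMonoid Λ.ReebChord Unit) (hw : w ∈ (D.weight base side).coeff.support) :
    (wordHeight ReebChord.height w).toAdd ≤ a.height := by
  let W : SFMonoid Λ.ReebChord Unit := .inr (FreeGroup.of () ^ D.crossings base 0) *
    (List.ofFn fun j : Fin D.l =>
      (.inl (.of (D.b j)) * .inr (FreeGroup.of () ^ D.crossings base j.succ) :
        SFMonoid Λ.ReebChord Unit)).prod
  have h1 : D.weight base side = D.sign side • word W := by
    have : ∀ l : List (SFMonoid Λ.ReebChord Unit),
        (word l.prod : SFAlg Λ.ReebChord Unit) = (l.map word).prod := fun l =>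
      map_list_prod (MonoidAlgebra.of ℤ (SFMonoid Λ.ReebChord Unit)) l
    rw [Disk.weight, word_mul, this, List.map_ofFn, tPow_eq_word]
    congr 4
    ext1 j
    simp only [Function.comp_apply, word_mul, word_inl, tPow_eq_word]
  have h2 : w = W := by
    rw [h1] at hw
    by_contra hne
    simp [word, MonoidAlgebra.of, Ne.symm hne] at hw
  have h3 : (wordHeight ReebChord.height W).toAdd = ∑ j, (D.b j).height := by
    simp only [W, wordHeight]
    rw [map_mul, map_list_prod, List.map_ofFn, List.prod_ofFn, toAdd_mul, toAdd_prod]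
    simp
  rw [h2, h3]
  exact D.sum_height_le

/-- The bound on words is inherited by sums. Finiteness of the set of disks plays no role, since a
`finsum` with infinite support is 0. -/
theorem isFiltered_of_isChekanovEliashberg {base : ℝ} {side : Λ.ReebChord → Bool}
    {𝓐 : SemiFreeDGA Λ.rot Λ.ReebChord Unit} (h : Λ.IsChekanovEliashberg base side 𝓐) :
    𝓐.IsFiltered ReebChord.height := by
  refine ⟨ReebChord.height_pos, fun a => ?_⟩
  rw [h.2 a, ceDifferential]
  refine finsum_induction (fun x : SFAlg Λ.ReebChord Unit =>
    ∀ w ∈ x.coeff.support, (wordHeight ReebChord.height w).toAdd ≤ a.height) (by simp) ?_ ?_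
  · intro x y hx hy w hw
    classical
    rcases Finset.mem_union.1 (Finsupp.support_add hw) with hw | hw
    · exact hx w hw
    · exact hy w hw
  · intro q w hw
    exact q.out.wordHeight_le base side w hw

end LegendrianKnot

end

/-! ### The theorem for Legendrian knots -/

theorem mainTheorem4 (Λ : LegendrianKnot) (base : ℝ) (hbase : Λ.IsBasePoint base)
    (side : Λ.ReebChord → Bool)
    (𝓐 : SemiFreeDGA Λ.rot Λ.ReebChord Unit) (h𝓐 : Λ.IsChekanovEliashberg base side 𝓐)
    {k : Type*} [CommRing k] (ε₁ ε₂ : Augmentation 𝓐 k) :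
    DGAHomotopic ε₁ ε₂ ↔ AugPlus.Isomorphic ε₁ ε₂ :=
  AugPlus.dgaHomotopic_iff_isomorphic (LegendrianKnot.isFiltered_of_isChekanovEliashberg h𝓐)
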